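/- Let $K$ be an infinite-dimensional metrizable Choquet simplex, that is, a nonempty compact convex subset of a locally convex Hausdorff real vector space $E$ that is metrizable, is not contained in a finite-dimensional affine subspace of $E$, and is such that the cone $\{(t,tx) : t\ge 0,\ x\in K\}\subset \mathbb R\times E$ is a lattice in its own order. Let $\operatorname{Aff} K$ be the Banach space of continuous affine functions $K\to\mathbb R$ with the supremum norm. Then there is a subgroup $G$ of $\operatorname{Aff} K$ such that: 1. $G$ is countable and dense in $\operatorname{Aff} K$, is free as an abelian group, and every finitely generated subgroup of $G$ is discrete. 2. With the strict ordering ($f\le g$ if and only if $f=g$ or $f(x)<g(x)$ for all $x\in K$), $G$ is a simple dimension group. 3. The constant function $\mathbf 1$ belongs to $G$ and is an order unit, and the trace space of $(G,\mathbf 1)$ is $K$: the map $x\mapsto (g\mapsto g(x))$ is an affine homeomorphism from $K$ onto $S(G,\mathbf 1)$. 4. $G$ is strongly anti-finite dimensional (Anti-FD): for every pro-finite dimensional dimension group $H$, every continuous group homomorphism $H\to G$ is zero. Here a *dimension group* is a partially ordered abelian group that is directed, unperforated ($ng\ge 0$ for some integer $n\ge 1$ implies $g\ge 0$) and has the Riesz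 interpolation property ($a_1,a_2\le b_1,b_2$ implies that some $c$ satisfies $a_1,a_2\le c\le b_1,b_2$). It is *simple* if it is nonzero and has no order ideals (convex directed subgroups) other than $0$ and itself. An *order unit* is an element $u\ge 0$ such that every element is at most some multiple $nu$, $n\in\mathbb N$. For an order unit $u$ of $H$, the *trace space* $S(H,u)$ is the convex set of positive group homomorphisms $\tau:H\to\mathbb R$ with $\tau(u)=1$, with the topology of pointwise convergence, and the *pure traces* are its extreme points. $(H,u)$ is *approximately divisible* if $\tau(H)$ is dense in $\mathbb R$ for every pure trace $\tau$. A dimension group is *pro-finite dimensional* if it is the direct limit, over a directed set, of positive homomorphisms $\phi_{\alpha\beta}:H_\alpha\to H_\beta$ between approximately divisible dimension groups $H_\alpha$ with order unit $u_\alpha$ and with only finitely many pure traces, where each $\phi_{\alpha\beta}(u_\alpha)$ is an order unit of $H_\beta$. A group homomorphism between partially ordered abelian groups with order unit (not necessarily positive) is *continuous* if it is continuous for the pseudo-norms $\|g\|=\sup\{|\tau(g)| : \tau\in S(H,u)\}$. -/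

import Mathlib

open Topology

universe u v

/-! ### Partially ordered abelian groups, traces, dimension groups -/

section OrderedGroups

/-- `w` is an order unit: `w ≥ 0` and every element is dominated by a multiple of `w`. -/
def IsOrderUnit {G : Type*} [AddCommGroup G] [PartialOrder G] (w : G) : Prop :=
  0 ≤ w ∧ ∀ g : G, ∃ n : ℕ, g ≤ n • w

/-- A dimension group: a partially ordered abelian group that is directed, unperforated, and has
the Riesz interpolation property. -/
structure IsDimensionGroup (G : Type*) [AddCommGroup G] [PartialOrder G]
    [IsOrderedAddMonoid G] : Prop where
  directed : ∀ a b : G, ∃ c : G, a ≤ c ∧ b ≤ c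
  unperforated : ∀ (n : ℕ) (g : G), 0 < n → 0 ≤ n • g → 0 ≤ g
  interpolation : ∀ a₁ a₂ b₁ b₂ : G, a₁ ≤ b₁ → a₁ ≤ b₂ → a₂ ≤ b₁ → a₂ ≤ b₂ →
    ∃ c : G, a₁ ≤ c ∧ a₂ ≤ c ∧ c ≤ b₁ ∧ c ≤ b₂

/-- An order ideal: a subgroup that is convex and directed (generated by its positive elements). -/
structure IsOrderIdeal {G : Type*} [AddCommGroup G] [PartialOrder G]
    (I : AddSubgroup G) : Prop where
  convex : ∀ a ∈ I, ∀ b ∈ I, ∀ g : G, a ≤ g → g ≤ b → g ∈ I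
  directed : ∀ g ∈ I, ∃ a ∈ I, ∃ b ∈ I, 0 ≤ a ∧ 0 ≤ b ∧ g = a - b

/-- A partially ordered abelian group is simple if it is nonzero and its only order ideals are
`0` and the whole group. -/
def IsSimpleOrdered (G : Type*) [AddCommGroup G] [PartialOrder G] : Prop :=
  Nontrivial G ∧ ∀ I : AddSubgroup G, IsOrderIdeal I → I = ⊥ ∨ I = ⊤

/-- The trace space `S(G, w)`: all positive group homomorphisms `τ : G → ℝ` with `τ w = 1`, as a
convex subset of `G → ℝ` with the topology of pointwise convergence. -/
def traceSpace (G : Type*) [AddCommGroup G] [PartialOrder G] (w : G) : Set (G → ℝ) :=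
  {τ | (∀ a b : G, τ (a + b) = τ a + τ b) ∧ (∀ g : G, 0 ≤ g → 0 ≤ τ g) ∧ τ w = 1}

/-- The pure traces `∂ₑ S(G, w)`. -/
def pureTraces (G : Type*) [AddCommGroup G] [PartialOrder G] (w : G) : Set (G → ℝ) :=
  (traceSpace G w).extremePoints ℝ

/-- `(G, w)` is approximately divisible: each pure trace has dense range in `ℝ`. -/
def IsApproximatelyDivisible (G : Type*) [AddCommGroup G] [PartialOrder G] (w : G) : Prop :=
  ∀ τ ∈ pureTraces G w, Dense (Set.range τ)

/-- The pseudo-norm of `(G, w)`: the supremum norm of `ĝ : τ ↦ τ g` on the trace space. (For an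
order unit `w` the values are bounded, since `-n • w ≤ g ≤ n • w` for some `n`.) -/
noncomputable def traceNorm {G : Type*} [AddCommGroup G] [PartialOrder G] (w g : G) : ℝ :=
  ⨆ τ : traceSpace G w, |(τ : G → ℝ) g|

/-- Continuity of a group homomorphism `(G, w) → (H, z)` for the pseudo-norms. The homomorphism is
not assumed positive, nor to map order units to order units. -/
def IsTraceNormContinuous {G H : Type*} [AddCommGroup G] [PartialOrder G]
    [AddCommGroup H] [PartialOrder H] (w : G) (z : H) (φ : G →+ H) : Prop :=
  ∀ a : G, ∀ ε > 0, ∃ δ > 0, ∀ b : G, traceNorm w (b - a) < δ → traceNorm z (φ b - φ a) < ε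

/-- A presentation of `H` as the direct limit, over a nonempty directed set, of positive group
homomorphisms between approximately divisible dimension groups `(obj i, unit i)` with finitely many
pure traces, such that the transition maps send the order units `unit i` to order units. The fields
`toLimit` to `zero_of_toLimit` say that `H`, with its order, is the direct limit. -/
structure ProFDPresentation (H : Type v) [AddCommGroup H] [PartialOrder H] where
  index : Type v
  [preorder : Preorder index]
  nonempty : Nonempty index
  directed : ∀ i j : index, ∃ k : index, i ≤ k ∧ j ≤ k
  obj : index → Type v
  [addCommGroup : ∀ i, AddCommGroup (obj i)]
  [partialOrder : ∀ i, PartialOrder (obj i)]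
  [isOrderedAddMonoid : ∀ i, IsOrderedAddMonoid (obj i)]
  isDimensionGroup : ∀ i, IsDimensionGroup (obj i)
  unit : ∀ i, obj i
  isOrderUnit : ∀ i, IsOrderUnit (unit i)
  approxDivisible : ∀ i, IsApproximatelyDivisible (obj i) (unit i)
  finite_pureTraces : ∀ i, (pureTraces (obj i) (unit i)).Finite
  map : ∀ i j, i ≤ j → (obj i →+o obj j)
  map_self : ∀ i (h : i ≤ i) (g : obj i), map i i h g = g
  map_map : ∀ i j k (hij : i ≤ j) (hjk : j ≤ k) (g : obj i),
    map j k hjk (map i j hij g) = map i k (hij.trans hjk) g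
  map_unit : ∀ i j (h : i ≤ j), IsOrderUnit (map i j h (unit i))
  toLimit : ∀ i, obj i →+o H
  toLimit_map : ∀ i j (h : i ≤ j) (g : obj i), toLimit j (map i j h g) = toLimit i g
  exists_toLimit : ∀ x : H, ∃ i, ∃ g : obj i, toLimit i g = x
  exists_nonneg_toLimit : ∀ x : H, 0 ≤ x → ∃ i, ∃ g : obj i, 0 ≤ g ∧ toLimit i g = x
  zero_of_toLimit : ∀ i (g : obj i), toLimit i g = 0 → ∃ j, ∃ h : i ≤ j, map i j h g = 0

/-- Pro-finite dimensional dimension groups (the class `𝓗`). -/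
def IsProFD (H : Type v) [AddCommGroup H] [PartialOrder H] [IsOrderedAddMonoid H] : Prop :=
  IsDimensionGroup H ∧ Nonempty (ProFDPresentation H)

/-- The strong anti-finite dimensional property (Anti-FD) of `(R, z)`: every continuous group
homomorphism from a pro-finite dimensional dimension group to `R` is zero. -/
def IsAntiFD (R : Type u) [AddCommGroup R] [PartialOrder R] (z : R) : Prop :=
  ∀ (H : Type v) [AddCommGroup H] [PartialOrder H] [IsOrderedAddMonoid H], IsProFD H →
    ∀ w : H, IsOrderUnit w → ∀ φ : H →+ R, IsTraceNormContinuous w z φ → φ = 0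

end OrderedGroups

/-! ### Choquet simplices and their affine functions -/

section Simplices

variable {E : Type u} [AddCommGroup E] [Module ℝ E]

/-- The cone over `K`, that is, the cone in `ℝ × E` with base `{1} × K`. -/
def coneOver (K : Set E) : Set (ℝ × E) :=
  {p | ∃ t : ℝ, 0 ≤ t ∧ ∃ x ∈ K, p = (t, t • x)}

/-- The cone `C` is a lattice in its own order, `a ≤ b` iff `b - a ∈ C`: any two elements have a
least upper bound and a greatest lower bound in `C`. -/
def IsLatticeCone {V : Type*} [AddCommGroup V] (C : Set V) : Prop :=
  ∀ a ∈ C, ∀ b ∈ C,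
    (∃ s ∈ C, s - a ∈ C ∧ s - b ∈ C ∧ ∀ d ∈ C, d - a ∈ C → d - b ∈ C → d - s ∈ C) ∧
    (∃ i ∈ C, a - i ∈ C ∧ b - i ∈ C ∧ ∀ d ∈ C, a - d ∈ C → b - d ∈ C → i - d ∈ C)

variable [TopologicalSpace E]

/-- A Choquet simplex (in a locally convex Hausdorff real vector space): a nonempty compact convex
set such that the cone over it is a lattice. -/
structure IsChoquetSimplex (K : Set E) : Prop where
  nonempty : K.Nonempty
  compact : IsCompact K
  convex : Convex ℝ K
  lattice : IsLatticeCone (coneOver K)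

/-- `Aff K`: the continuous affine functions `K → ℝ`. As a subspace of `C(K, ℝ)` it carries the
compact-open topology, which for compact `K` is that of the supremum norm. -/
def AffineFunctions (K : Set E) : Submodule ℝ C(K, ℝ) where
  carrier := {f | ∀ (x y z : K) (a b : ℝ), 0 ≤ a → 0 ≤ b → a + b = 1 →
    (z : E) = a • (x : E) + b • (y : E) → f z = a * f x + b * f y}
  add_mem' := by
    intro f g hf hg x y z a b ha hb hab hz
    simp only [ContinuousMap.add_apply, hf x y z a b ha hb hab hz, hg x y z a b ha hb hab hz]
    ring
  zero_mem' := by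
    intro x y z a b _ _ _ _
    simp
  smul_mem' := by
    intro c f hf x y z a b ha hb hab hz
    simp only [ContinuousMap.smul_apply, smul_eq_mul, hf x y z a b ha hb hab hz]
    ring

/-- A subgroup `G` of `Aff K`, to be equipped with the strict ordering. (A type synonym, because
`G` itself would inherit the pointwise ordering.) -/
def StrictlyOrdered {K : Set E} (G : AddSubgroup (AffineFunctions K)) : Type u := G

namespace StrictlyOrdered

variable {K : Set E} {G : AddSubgroup (AffineFunctions K)}

instance : AddCommGroup (StrictlyOrdered G) := inferInstanceAs (AddCommGroup G)

/-- An element of the group `G`, as a function on `K`. -/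
def val (g : StrictlyOrdered G) : C(K, ℝ) := (show G from g).1.1

theorem val_injective : Function.Injective (val : StrictlyOrdered G → C(K, ℝ)) :=
  fun _ _ h => Subtype.ext (Subtype.ext h)

theorem val_add (f g : StrictlyOrdered G) : (f + g).val = f.val + g.val := rfl

/-- The strict ordering: `f ≤ g` if and only if `f = g` or `f x < g x` for all `x ∈ K`. -/
instance : PartialOrder (StrictlyOrdered G) where
  le f g := f = g ∨ ∀ x : K, f.val x < g.val x
  le_refl f := Or.inl rfl
  le_trans := by
    rintro f g h (rfl | hfg) (rfl | hgh)
    · exact Or.inl rfl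
    · exact Or.inr hgh
    · exact Or.inr hfg
    · exact Or.inr fun x => (hfg x).trans (hgh x)
  le_antisymm := by
    rintro f g (rfl | hfg) (hgf | hgf)
    · rfl
    · rfl
    · exact hgf.symm
    · exact val_injective (ContinuousMap.ext fun x => absurd (hfg x) (hgf x).asymm)

instance : IsOrderedAddMonoid (StrictlyOrdered G) where
  add_le_add_left := by
    rintro f g (rfl | hfg) h
    · exact Or.inl rfl
    · refine Or.inr fun x => ?_
      simp only [val_add, ContinuousMap.add_apply]
      linarith [hfg x]

end StrictlyOrdered

end Simplices

/-! ### Dimension groups and their pure traces. -/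

section RieszGroups

variable {H : Type*} [AddCommGroup H]

/-! Since `K` is compact and metrizable, `Aff K` is a separable normed space, and it is
infinite-dimensional because `K` is. It therefore has a countable dense subset `B` that is
`ℝ`-linearly independent and contains `1`. The group `G` is the `ℤ`-span of `B`. It is countable,
dense and free on `B`. A finitely generated subgroup lies in the `ℤ`-span of finitely many
independent vectors, which is a lattice and hence discrete.

The order properties use only that `G` is dense and contains `1`. Interpolation is Edwards' theorem
(`AffineFunctions.exists_between`), obtained from Hahn-Banach and Riesz refinement in the cone over
`K`, followed by approximation. A normalized positive functional on `G` is a point evaluation by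
Hahn-Banach and compactness (`AffineFunctions.exists_eq_eval`).

Anti-FD is a clash between divisibility and discreteness. It suffices to treat one stage of the
limit, with finitely many pure traces. Distinct pure traces are disjoint and each takes arbitrarily
small positive values, so together they map the stage densely into `ℝⁿ`
(`IsDimensionGroup.exists_approx`). A continuous homomorphism into a normed space then has range in
a finite-dimensional subspace. If its values are integral combinations of `B`, they lie in the
lattice spanned by a finite part of `B`. Continuity kills all sufficiently small elements, and every
element is a small one plus a multiple of another small one. -/

theorem map_sub_of_map_add {τ : H → ℝ} (hτ : ∀ a b, τ (a + b) = τ a + τ b) (a b : H) :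
    τ (a - b) = τ a - τ b :=
  map_sub (AddMonoidHom.mk' τ hτ) a b

theorem map_zero_of_map_add {τ : H → ℝ} (hτ : ∀ a b, τ (a + b) = τ a + τ b) : τ 0 = 0 :=
  map_zero (AddMonoidHom.mk' τ hτ)

theorem map_nsmul_of_map_add {τ : H → ℝ} (hτ : ∀ a b, τ (a + b) = τ a + τ b) (n : ℕ) (a : H) :
    τ (n • a) = n * τ a := by
  simpa using map_nsmul (AddMonoidHom.mk' τ hτ) n a

theorem map_zsmul_of_map_add {τ : H → ℝ} (hτ : ∀ a b, τ (a + b) = τ a + τ b) (n : ℤ) (a : H) :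
    τ (n • a) = n * τ a := by
  simpa using map_zsmul (AddMonoidHom.mk' τ hτ) n a

theorem map_sum_of_map_add {ι : Type*} {τ : H → ℝ} (hτ : ∀ a b, τ (a + b) = τ a + τ b)
    (s : Finset ι) (f : ι → H) : τ (∑ i ∈ s, f i) = ∑ i ∈ s, τ (f i) :=
  map_sum (AddMonoidHom.mk' τ hτ) f s

variable [PartialOrder H]

/-- The trace space is convex. -/
theorem convex_traceSpace (w : H) : Convex ℝ (traceSpace H w) := by
  rintro σ ⟨s1, s2, s3⟩ τ ⟨t1, t2, t3⟩ a b ha hb hab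
  refine ⟨fun g h => ?_, fun g hg => ?_, ?_⟩
  · simp only [Pi.add_apply, Pi.smul_apply, smul_eq_mul, s1, t1]; ring
  · simp only [Pi.add_apply, Pi.smul_apply, smul_eq_mul]
    exact add_nonneg (mul_nonneg ha (s2 g hg)) (mul_nonneg hb (t2 g hg))
  · simp only [Pi.add_apply, Pi.smul_apply, smul_eq_mul, s3, t3]; linarith

theorem traceNorm_le {w g : H} {r : ℝ} (hr : 0 ≤ r)
    (h : ∀ τ ∈ traceSpace H w, |τ g| ≤ r) : traceNorm w g ≤ r :=
  Real.iSup_le (fun τ => h τ.1 τ.2) hr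

variable [IsOrderedAddMonoid H]

theorem mono_of_map_add {τ : H → ℝ} (hτ : ∀ a b, τ (a + b) = τ a + τ b)
    (h0 : ∀ g : H, 0 ≤ g → 0 ≤ τ g) {a b : H} (h : a ≤ b) : τ a ≤ τ b := by
  have := h0 (b - a) (sub_nonneg.2 h)
  rw [map_sub_of_map_add hτ] at this
  linarith

/-- An order unit bounds every element from both sides. -/
theorem IsOrderUnit.exists_abs_le {w : H} (hw : IsOrderUnit w) (g : H) :
    ∃ n : ℕ, g ≤ n • w ∧ -g ≤ n • w := by
  obtain ⟨n, hn⟩ := hw.2 g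
  obtain ⟨m, hm⟩ := hw.2 (-g)
  refine ⟨n + m, hn.trans ?_, hm.trans ?_⟩
  · exact nsmul_le_nsmul_left hw.1 (Nat.le_add_right n m)
  · exact nsmul_le_nsmul_left hw.1 (Nat.le_add_left m n)

namespace IsDimensionGroup

/-- Riesz decomposition. -/
theorem decomposition (hH : IsDimensionGroup H) {x a b : H} (hx : 0 ≤ x) (ha : 0 ≤ a)
    (hb : 0 ≤ b) (h : x ≤ a + b) :
    ∃ y z, 0 ≤ y ∧ 0 ≤ z ∧ y ≤ a ∧ z ≤ b ∧ x = y + z := by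
  obtain ⟨c, h0, h1, h2, h3⟩ := hH.interpolation 0 (x - b) a x ha hx
    (by rwa [sub_le_iff_le_add]) (by simpa using hb)
  exact ⟨c, x - c, h0, sub_nonneg.2 h3, h2, by rwa [sub_le_comm], by abel⟩

/-- Elements of a dimension group are differences of positive elements. -/
theorem exists_nonneg_sub (hH : IsDimensionGroup H) (g : H) :
    ∃ p q : H, 0 ≤ p ∧ 0 ≤ q ∧ g = p - q := by
  obtain ⟨c, h0, hg⟩ := hH.directed 0 g
  exact ⟨c, c - g, h0, sub_nonneg.2 hg, by abel⟩

/-- A function which is additive on the positive cone extends to the whole group. -/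
theorem exists_extension (hH : IsDimensionGroup H) (σ : H → ℝ)
    (hσ : ∀ a b, 0 ≤ a → 0 ≤ b → σ (a + b) = σ a + σ b) :
    ∃ τ : H → ℝ, (∀ a b, τ (a + b) = τ a + τ b) ∧ ∀ a, 0 ≤ a → τ a = σ a := by
  choose p q hp hq hpq using hH.exists_nonneg_sub
  have key : ∀ g a b, 0 ≤ a → 0 ≤ b → g = a - b → σ (p g) - σ (q g) = σ a - σ b := by
    intro g a b ha hb h
    have : p g + b = a + q g := by
      have h1 := hpq g
      rw [h, sub_eq_sub_iff_add_eq_add] at h1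
      rw [add_comm (p g), ← h] at *
      rw [h1, add_comm]
    have := congrArg σ this
    rw [hσ _ _ (hp g) hb, hσ _ _ ha (hq g)] at this
    linarith
  refine ⟨fun g => σ (p g) - σ (q g), fun a b => ?_, fun a ha => ?_⟩
  · have := key (a + b) (p a + p b) (q a + q b) (add_nonneg (hp a) (hp b))
      (add_nonneg (hq a) (hq b)) (by nth_rw 1 [hpq a, hpq b]; abel)
    simp only [this, hσ _ _ (hp a) (hp b), hσ _ _ (hq a) (hq b)]
    ring
  · have h0 := hσ 0 0 le_rfl le_rfl
    simp only [add_zero] at h0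
    simp only [key a a 0 ha le_rfl (by simp)]
    linarith

/-- Purity of a trace `τ`: an additive function on the positive cone that is dominated by `τ` is a
multiple of `τ`. -/
theorem eq_mul_of_le_pureTrace (hH : IsDimensionGroup H) {w : H} (hw : IsOrderUnit w) {τ : H → ℝ}
    (hτ : τ ∈ pureTraces H w) {σ : H → ℝ}
    (hσ : ∀ a b, 0 ≤ a → 0 ≤ b → σ (a + b) = σ a + σ b)
    (h0 : ∀ a, 0 ≤ a → 0 ≤ σ a) (hle : ∀ a, 0 ≤ a → σ a ≤ τ a) {a : H} (ha : 0 ≤ a) :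
    σ a = σ w * τ a := by
  obtain ⟨ρ, hρ, hρσ⟩ := hH.exists_extension σ hσ
  obtain ⟨⟨h1, h2, h3⟩, hpure⟩ := hτ
  have hc0 := h0 w hw.1
  have hc1 := hle w hw.1
  rw [h3] at hc1
  -- `τ` is the midpoint of `τ ± (ρ - σ w • τ) / 2`. Both are positive because `0 ≤ σ ≤ τ` on the
  -- cone and `0 ≤ σ w ≤ 1`.
  have m1 : (fun g => τ g + (ρ g - σ w * τ g) / 2) ∈ traceSpace H w := by
    refine ⟨fun a b => ?_, fun g hg => ?_, ?_⟩
    · simp only [h1, hρ]; ring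
    · simp only [hρσ g hg]
      nlinarith [h0 g hg, h2 g hg, mul_nonneg hc0 (h2 g hg)]
    · simp only [h3, hρσ w hw.1]; ring
  have m2 : (fun g => τ g - (ρ g - σ w * τ g) / 2) ∈ traceSpace H w := by
    refine ⟨fun a b => ?_, fun g hg => ?_, ?_⟩
    · simp only [h1, hρ]; ring
    · simp only [hρσ g hg]
      nlinarith [h0 g hg, h2 g hg, hle g hg, mul_nonneg hc0 (h2 g hg)]
    · simp only [h3, hρσ w hw.1]; ring
  have := congrFun (hpure m1 m2 ⟨1 / 2, 1 / 2, by norm_num, by norm_num, by norm_num, by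
    ext g; simp only [Pi.add_apply, Pi.smul_apply, smul_eq_mul]; ring⟩) a
  simp only [hρσ a ha] at this
  linarith

/-- If an additive function `f` is dominated on the positive cone by a pure trace `τ`, then its
positive part relative to a face `S` of the positive cone is a multiple of `τ`. -/
theorem exists_isLUB_of_le_pureTrace (hH : IsDimensionGroup H) {w : H} (hw : IsOrderUnit w)
    {τ : H → ℝ} (hτ : τ ∈ pureTraces H w) {f : H → ℝ} (hf : ∀ a b, f (a + b) = f a + f b)
    (hle : ∀ a, 0 ≤ a → f a ≤ τ a) {S : Set H} (hS0 : 0 ∈ S)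
    (hSadd : ∀ a ∈ S, ∀ b ∈ S, a + b ∈ S) (hSle : ∀ b ∈ S, ∀ a, 0 ≤ a → a ≤ b → a ∈ S) :
    ∃ c : ℝ, ∀ a, 0 ≤ a → IsLUB (f '' {z | 0 ≤ z ∧ z ≤ a ∧ z ∈ S}) (c * τ a) := by
  obtain ⟨h1, h2, -⟩ := hτ.1
  set A : H → Set ℝ := fun a => f '' {z | 0 ≤ z ∧ z ≤ a ∧ z ∈ S} with hA
  have bd : ∀ a, τ a ∈ upperBounds (A a) := by
    rintro a _ ⟨z, ⟨hz0, hza, -⟩, rfl⟩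
    exact (hle z hz0).trans (mono_of_map_add h1 h2 hza)
  have m0 : ∀ a, 0 ≤ a → (0 : ℝ) ∈ A a := fun a ha =>
    ⟨0, ⟨le_rfl, ha, hS0⟩, map_zero_of_map_add hf⟩
  have lub : ∀ a, 0 ≤ a → IsLUB (A a) (sSup (A a)) := fun a ha =>
    isLUB_csSup ⟨0, m0 a ha⟩ ⟨_, bd a⟩
  refine ⟨sSup (A w), fun a ha => ?_⟩
  -- The supremum is additive in `a` by Riesz decomposition, `S` being a face, and it lies between
  -- `0` and `τ`; purity applies.
  rw [← hH.eq_mul_of_le_pureTrace hw hτ (σ := fun a => sSup (A a)) ?_ ?_ ?_ ha]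
  · exact lub a ha
  · intro a b ha hb
    rw [← csSup_add ⟨0, m0 a ha⟩ ⟨_, bd a⟩ ⟨0, m0 b hb⟩ ⟨_, bd b⟩]
    congr 1
    ext r
    rw [Set.mem_add]
    constructor
    · rintro ⟨z, ⟨hz0, hz, hzS⟩, rfl⟩
      obtain ⟨x, y, hx, hy, hxa, hyb, rfl⟩ := hH.decomposition hz0 ha hb hz
      exact ⟨_, ⟨x, ⟨hx, hxa, hSle _ hzS x hx (le_add_of_nonneg_right hy)⟩, rfl⟩, _,
        ⟨y, ⟨hy, hyb, hSle _ hzS y hy (le_add_of_nonneg_left hx)⟩, rfl⟩, (hf x y).symm⟩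
    · rintro ⟨_, ⟨x, ⟨hx, hxa, hxS⟩, rfl⟩, _, ⟨y, ⟨hy, hyb, hyS⟩, rfl⟩, rfl⟩
      exact ⟨x + y, ⟨add_nonneg hx hy, add_le_add hxa hyb, hSadd x hxS y hyS⟩, hf x y⟩
  · exact fun a ha => (lub a ha).1 (m0 a ha)
  · exact fun a ha => (lub a ha).2 (bd a)

/-- Two positive elements not annihilated by a pure trace have a common lower bound that is not
annihilated either. -/
theorem exists_le_le_pos (hH : IsDimensionGroup H) {w : H} (hw : IsOrderUnit w) {τ : H → ℝ}
    (hτ : τ ∈ pureTraces H w) {x y : H} (hx : 0 ≤ x) (hy : 0 ≤ y) (hτx : 0 < τ x)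
    (hτy : 0 < τ y) : ∃ z, 0 ≤ z ∧ z ≤ x ∧ z ≤ y ∧ 0 < τ z := by
  obtain ⟨h1, h2, -⟩ := hτ.1
  by_contra! hcon
  -- `S` is the face generated by `x`. Testing at `x` gives `c ≥ 1`. If `τ` killed all common lower
  -- bounds, testing at `y` would give `c ≤ 0`.
  obtain ⟨c, hc⟩ := hH.exists_isLUB_of_le_pureTrace hw hτ h1 (fun a _ => le_rfl)
    (S := {z | ∃ n : ℕ, z ≤ n • x}) ⟨0, by simp⟩
    (by
      rintro a ⟨n, hn⟩ b ⟨m, hm⟩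
      exact ⟨n + m, by rw [add_nsmul]; exact add_le_add hn hm⟩)
    (by
      rintro b ⟨n, hn⟩ a _ hab
      exact ⟨n, hab.trans hn⟩)
  have hzero : ∀ n : ℕ, ∀ z, 0 ≤ z → z ≤ y → z ≤ n • x → τ z ≤ 0 := by
    intro n
    induction n with
    | zero =>
      intro z hz _ hz'
      rw [le_antisymm (by simpa using hz') hz, map_zero_of_map_add h1]
    | succ n ih =>
      intro z hz hzy hzx
      rw [succ_nsmul] at hzx
      obtain ⟨p, q, hp, hq, hpx, hqx, rfl⟩ := hH.decomposition hz (nsmul_nonneg hx n) hx hzx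
      rw [h1]
      linarith [ih p hp ((le_add_of_nonneg_right hq).trans hzy) hpx,
        hcon q hq hqx ((le_add_of_nonneg_left hp).trans hzy)]
  have e1 : τ x ≤ c * τ x := (hc x hx).1 ⟨x, ⟨hx, le_rfl, 1, by simp⟩, rfl⟩
  have e2 : c * τ y ≤ 0 := (hc y hy).2 (by
    rintro _ ⟨z, ⟨hz, hzy, n, hzn⟩, rfl⟩
    exact hzero n z hz hzy hzn)
  have c1 : 1 ≤ c := by
    by_contra! h
    nlinarith
  nlinarith

/-- Distinct pure traces are disjoint. -/
theorem exists_separating (hH : IsDimensionGroup H) {w : H} (hw : IsOrderUnit w) {τ ρ : H → ℝ}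
    (hτ : τ ∈ pureTraces H w) (hρ : ρ ∈ pureTraces H w) (hne : τ ≠ ρ) {a : H} (ha : 0 ≤ a)
    {δ : ℝ} (hδ : 0 < δ) : ∃ z, 0 ≤ z ∧ z ≤ a ∧ τ (a - z) < δ ∧ ρ z < δ := by
  obtain ⟨t1, t2, t3⟩ := hτ.1
  obtain ⟨r1, r2, r3⟩ := hρ.1
  obtain ⟨c, hc⟩ := hH.exists_isLUB_of_le_pureTrace hw hτ (f := fun g => τ g - ρ g)
    (fun a b => by simp only [t1, r1]; ring) (fun a ha => by linarith [r2 a ha])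
    (Set.mem_univ 0) (fun _ _ _ _ => Set.mem_univ _) (fun _ _ _ _ _ => Set.mem_univ _)
  obtain ⟨d, hd⟩ := hH.exists_isLUB_of_le_pureTrace hw hρ (f := fun g => ρ g - τ g)
    (fun a b => by simp only [t1, r1]; ring) (fun a ha => by linarith [t2 a ha])
    (Set.mem_univ 0) (fun _ _ _ _ => Set.mem_univ _) (fun _ _ _ _ _ => Set.mem_univ _)
  -- This is `(ρ - τ)⁺ = (τ - ρ)⁺ + ρ - τ`, where the positive parts are `d • ρ` and `c • τ`. At `w`
  -- it gives `d = c`, hence `(c - 1)(τ - ρ) = 0` and `c = 1`.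
  have key : ∀ b, 0 ≤ b → d * ρ b = ρ b - τ b + c * τ b := by
    intro b hb
    apply le_antisymm
    · refine (hd b hb).2 ?_
      rintro _ ⟨z, ⟨hz, hzb, -⟩, rfl⟩
      have := (hc b hb).1 ⟨b - z, ⟨sub_nonneg.2 hzb, sub_le_self b hz, Set.mem_univ _⟩, rfl⟩
      simp only [map_sub_of_map_add t1, map_sub_of_map_add r1] at this
      simp only
      linarith
    · have : c * τ b ≤ d * ρ b - (ρ b - τ b) := by
        refine (hc b hb).2 ?_
        rintro _ ⟨z, ⟨hz, hzb, -⟩, rfl⟩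
        have := (hd b hb).1 ⟨b - z, ⟨sub_nonneg.2 hzb, sub_le_self b hz, Set.mem_univ _⟩, rfl⟩
        simp only [map_sub_of_map_add t1, map_sub_of_map_add r1] at this
        simp only
        linarith
      linarith
  have hdc : d = c := by
    have := key w hw.1
    rw [t3, r3] at this
    linarith
  have hc1 : c = 1 := by
    by_contra hc1
    apply hne
    have hpos : ∀ b, 0 ≤ b → τ b = ρ b := by
      intro b hb
      have := key b hb
      rw [hdc] at this
      have : (c - 1) * (τ b - ρ b) = 0 := by linarith
      rcases mul_eq_zero.1 this with h | h
      · exact absurd (by linarith) hc1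
      · linarith
    ext g
    obtain ⟨p, q, hp, hq, rfl⟩ := hH.exists_nonneg_sub g
    rw [map_sub_of_map_add t1, map_sub_of_map_add r1, hpos p hp, hpos q hq]
  subst hc1
  obtain ⟨_, ⟨z, ⟨hz, hza, -⟩, rfl⟩, hlt, -⟩ :=
    (hc a ha).exists_between (show 1 * τ a - δ < 1 * τ a by linarith)
  simp only at hlt
  refine ⟨z, hz, hza, ?_, ?_⟩
  · rw [map_sub_of_map_add t1]
    linarith [r2 z hz]
  · linarith [mono_of_map_add t1 t2 hza]

/-- A pure trace is separated from finitely many others below any positive element. -/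
theorem exists_separating_finset (hH : IsDimensionGroup H) {w : H} (hw : IsOrderUnit w)
    {τ : H → ℝ} (hτ : τ ∈ pureTraces H w) (T : Finset (H → ℝ))
    (hT : ∀ ρ ∈ T, ρ ∈ pureTraces H w) {a : H} (ha : 0 ≤ a) {δ : ℝ} (hδ : 0 < δ) :
    ∃ z, 0 ≤ z ∧ z ≤ a ∧ τ (a - z) < δ ∧ ∀ ρ ∈ T, ρ ≠ τ → ρ z < δ := by
  classical
  obtain ⟨t1, t2, -⟩ := hτ.1
  induction T using Finset.induction_on generalizing δ with
  | empty => exact ⟨a, ha, le_rfl, by simpa [map_zero_of_map_add t1] using hδ, by simp⟩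
  | insert σ T hσT ih =>
    obtain ⟨y, hy, hya, hτy, hy'⟩ :=
      ih (fun ρ hρ => hT ρ (Finset.mem_insert_of_mem hρ)) (half_pos hδ)
    by_cases hσ : σ = τ
    · refine ⟨y, hy, hya, by linarith, fun ρ hρ hne => ?_⟩
      rcases Finset.mem_insert.1 hρ with rfl | hρ
      · exact absurd hσ hne
      · linarith [hy' ρ hρ hne]
    · obtain ⟨z, hz, hzy, hτz, hσz⟩ := hH.exists_separating hw hτ
        (hT σ (Finset.mem_insert_self σ T)) (Ne.symm hσ) hy (half_pos hδ)
      refine ⟨z, hz, hzy.trans hya, ?_, fun ρ hρ hne => ?_⟩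
      · rw [map_sub_of_map_add t1] at *
        linarith
      · rcases Finset.mem_insert.1 hρ with rfl | hρ'
        · linarith
        · obtain ⟨r1, r2, -⟩ := (hT ρ hρ).1
          linarith [hy' ρ hρ' hne, mono_of_map_add r1 r2 hzy]

/-- A pure trace with dense range takes arbitrarily small positive values on the positive cone. -/
theorem exists_nonneg_small (hH : IsDimensionGroup H) {w : H} (hw : IsOrderUnit w) {τ : H → ℝ}
    (hτ : τ ∈ pureTraces H w) (hd : Dense (Set.range τ)) {ε : ℝ} (hε : 0 < ε) :
    ∃ z, 0 ≤ z ∧ 0 < τ z ∧ τ z < ε := by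
  obtain ⟨h1, h2, h3⟩ := hτ.1
  by_contra! hcon
  -- Without positive values below `ε`, splitting a positive element repeatedly must stop at
  -- elements that `τ` cannot split. By `exists_le_le_pos` these all have the same value, so the
  -- range of `τ` is cyclic and not dense.
  set atoms : Set H := {a | 0 ≤ a ∧ 0 < τ a ∧ ∀ y, 0 ≤ y → y ≤ a → τ y = 0 ∨ τ y = τ a}
  have same : ∀ a ∈ atoms, ∀ b ∈ atoms, τ a = τ b := by
    rintro a ⟨ha, hτa, ha'⟩ b ⟨hb, hτb, hb'⟩
    obtain ⟨z, hz, hza, hzb, hτz⟩ := hH.exists_le_le_pos hw hτ ha hb hτa hτb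
    rw [← (ha' z hz hza).resolve_left hτz.ne', ← (hb' z hz hzb).resolve_left hτz.ne']
  have decomp : ∀ N : ℕ, ∀ z, 0 ≤ z → τ z < N * ε → τ z ∈ AddSubgroup.closure (τ '' atoms) := by
    intro N
    induction N with
    | zero =>
      intro z hz h
      simp only [Nat.cast_zero, zero_mul] at h
      exact absurd (h2 z hz) (not_le.2 h)
    | succ N ih =>
      intro z hz h
      push_cast at h
      by_cases hz0 : τ z = 0
      · rw [hz0]; exact zero_mem _
      by_cases hza : z ∈ atoms
      · exact AddSubgroup.subset_closure ⟨z, hza, rfl⟩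
      have : ∃ y, 0 ≤ y ∧ y ≤ z ∧ τ y ≠ 0 ∧ τ y ≠ τ z := by
        by_contra! hc
        exact hza ⟨hz, lt_of_le_of_ne (h2 z hz) (Ne.symm hz0), fun y hy hyz =>
          or_iff_not_imp_left.2 (hc y hy hyz)⟩
      obtain ⟨y, hy, hyz, hy0, hyne⟩ := this
      have hzy := sub_nonneg.2 hyz
      have e : τ z = τ y + τ (z - y) := by rw [← h1]; congr 1; abel
      have p1 := hcon y hy (lt_of_le_of_ne (h2 y hy) (Ne.symm hy0))
      have p2 := hcon (z - y) hzy (lt_of_le_of_ne (h2 _ hzy) (fun h => hyne (by linarith)))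
      rw [e]
      exact add_mem (ih y hy (by linarith)) (ih _ hzy (by linarith))
  have mem : ∀ g, τ g ∈ AddSubgroup.closure (τ '' atoms) := by
    have pos : ∀ g, 0 ≤ g → τ g ∈ AddSubgroup.closure (τ '' atoms) := by
      intro g hg
      obtain ⟨N, hN⟩ := exists_nat_gt (τ g / ε)
      exact decomp N g hg (by rwa [div_lt_iff₀ hε] at hN)
    intro g
    obtain ⟨p, q, hp, hq, rfl⟩ := hH.exists_nonneg_sub g
    rw [map_sub_of_map_add h1]
    exact sub_mem (pos p hp) (pos q hq)
  have hne : atoms.Nonempty := by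
    by_contra hne
    have := mem w
    rw [Set.not_nonempty_iff_eq_empty.1 hne, h3] at this
    simp at this
  obtain ⟨a, ha⟩ := hne
  have himg : τ '' atoms = {τ a} := by
    ext r
    constructor
    · rintro ⟨b, hb, rfl⟩
      exact same b hb a ha
    · rintro rfl
      exact ⟨a, ha, rfl⟩
  have hτa : 0 < τ a := ha.2.1
  obtain ⟨_, ⟨g, rfl⟩, hr0, hr1⟩ := hd.exists_mem_open (isOpen_Ioo (a := 0) (b := τ a))
    ⟨τ a / 2, by constructor <;> linarith⟩
  have := mem g
  rw [himg, AddSubgroup.mem_closure_singleton] at this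
  obtain ⟨n, hn⟩ := this
  rw [← hn, zsmul_eq_mul] at hr0 hr1
  have n0 : 0 < n := by exact_mod_cast pos_of_mul_pos_left hr0 hτa.le
  have n1 : (n : ℝ) < 1 := by
    by_contra! h
    nlinarith
  have : n < 1 := by exact_mod_cast n1
  omega

/-- Approximation of the coordinate vectors by values of finitely many pure traces. -/
theorem exists_approx_single (hH : IsDimensionGroup H) {w : H} (hw : IsOrderUnit w)
    (hw' : IsApproximatelyDivisible H w) {τ : H → ℝ} (hτ : τ ∈ pureTraces H w)
    (T : Finset (H → ℝ)) (hT : ∀ ρ ∈ T, ρ ∈ pureTraces H w) (t : ℝ) {ε : ℝ} (hε : 0 < ε) :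
    ∃ h : H, |τ h - t| < ε ∧ ∀ ρ ∈ T, ρ ≠ τ → |ρ h| < ε := by
  obtain ⟨h1, h2, h3⟩ := hτ.1
  obtain ⟨z, hz, hz0, hzε⟩ := hH.exists_nonneg_small hw hτ (hw' τ hτ) hε
  -- The witness is `⌊t / τ y⌋ • y` with `y ≤ z` and `τ y > τ z / 2`. Its error at `τ` is at most `τ
  -- y < ε`. At the other traces it is at most `(|t| / τ y + 1) * η`, and this `η` keeps that below
  -- `ε`.
  set η : ℝ := ε * τ z / (4 * (|t| + 1) + 4 * ε) with hη
  have hden : 0 < 4 * (|t| + 1) + 4 * ε := by positivity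
  have hη0 : 0 < η := by positivity
  have hη' : η * (4 * (|t| + 1) + 4 * ε) = ε * τ z := by rw [hη]; field_simp
  obtain ⟨y, hy, hyz, hy1, hy2⟩ := hH.exists_separating_finset hw hτ T hT hz hη0
  rw [map_sub_of_map_add h1] at hy1
  have hyτ : τ z / 2 < τ y := by
    have : η ≤ τ z / 4 := by
      rw [hη, div_le_iff₀ hden]
      nlinarith [abs_nonneg t]
    linarith
  have hyle := mono_of_map_add h1 h2 hyz
  have hy0 : 0 < τ y := by linarith
  refine ⟨⌊t / τ y⌋ • y, ?_, fun ρ hρ hne => ?_⟩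
  · rw [map_zsmul_of_map_add h1]
    have e1 := Int.floor_le (t / τ y)
    have e2 := Int.lt_floor_add_one (t / τ y)
    rw [le_div_iff₀ hy0] at e1
    rw [div_lt_iff₀ hy0] at e2
    rw [abs_lt]
    constructor <;> nlinarith
  · obtain ⟨r1, r2, -⟩ := (hT ρ hρ).1
    rw [map_zsmul_of_map_add r1, abs_mul, abs_of_nonneg (r2 y hy)]
    have hm : |(⌊t / τ y⌋ : ℝ)| ≤ |t| / τ y + 1 := by
      have e1 := Int.floor_le (t / τ y)
      have e2 := Int.lt_floor_add_one (t / τ y)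
      have e3 := le_abs_self (t / τ y)
      have e4 := neg_abs_le (t / τ y)
      rw [abs_div, abs_of_pos hy0] at e3 e4
      rw [abs_le]
      constructor <;> linarith
    have hm' : |(⌊t / τ y⌋ : ℝ)| * τ y ≤ |t| + τ y := by
      calc _ ≤ (|t| / τ y + 1) * τ y := by gcongr
        _ = _ := by field_simp
    have hρy := hy2 ρ hρ hne
    by_contra! hcon
    have b1 : ε ≤ |(⌊t / τ y⌋ : ℝ)| * η := hcon.trans (by gcongr)
    have b2 : ε * τ y ≤ (|t| + τ y) * η := by
      calc ε * τ y ≤ (|(⌊t / τ y⌋ : ℝ)| * η) * τ y := by gcongr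
        _ = (|(⌊t / τ y⌋ : ℝ)| * τ y) * η := by ring
        _ ≤ _ := by gcongr
    have b3 : (|t| + τ y) * η ≤ (|t| + ε) * η := by gcongr; linarith
    nlinarith

/-- Density of the image of an approximately divisible dimension group in `ℝⁿ`, for finitely many
pure traces. -/
theorem exists_approx (hH : IsDimensionGroup H) {w : H} (hw : IsOrderUnit w)
    (hw' : IsApproximatelyDivisible H w) (T : Finset (H → ℝ))
    (hT : ∀ ρ ∈ T, ρ ∈ pureTraces H w) (t : (H → ℝ) → ℝ) {ε : ℝ} (hε : 0 < ε) :
    ∃ h : H, ∀ ρ ∈ T, |ρ h - t ρ| < ε := by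
  classical
  suffices ∀ S ⊆ T, ∀ ε > 0, ∃ h : H, ∀ ρ ∈ T, |ρ h - if ρ ∈ S then t ρ else 0| < ε by
    obtain ⟨h, hh⟩ := this T subset_rfl ε hε
    exact ⟨h, fun ρ hρ => by simpa [hρ] using hh ρ hρ⟩
  intro S
  induction S using Finset.induction_on with
  | empty =>
    intro _ ε hε
    exact ⟨0, fun ρ hρ => by simpa [map_zero_of_map_add (hT ρ hρ).1.1] using hε⟩
  | insert τ S hτS ih =>
    intro hST ε hε
    have hτT := hST (Finset.mem_insert_self τ S)
    obtain ⟨g, hg⟩ := ih ((Finset.subset_insert τ S).trans hST) (ε / 2) (half_pos hε)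
    obtain ⟨h, hh, hh'⟩ := hH.exists_approx_single hw hw' (hT τ hτT) T hT (t τ) (half_pos hε)
    refine ⟨g + h, fun ρ hρ => ?_⟩
    have e1 := hg ρ hρ
    rw [(hT ρ hρ).1.1]
    by_cases hρτ : ρ = τ
    · subst hρτ
      simp only [hτS, if_false, Finset.mem_insert_self, if_true, sub_zero] at *
      rw [abs_lt] at *
      constructor <;> linarith
    · have e2 := hh' ρ hρ hρτ
      simp only [Finset.mem_insert, hρτ, false_or]
      rw [abs_lt] at *
      constructor <;> linarith

end IsDimensionGroup

theorem abs_le_of_mem_traceSpace {w g : H} {n : ℕ} (h1 : g ≤ n • w) (h2 : -g ≤ n • w)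
    {τ : H → ℝ} (hτ : τ ∈ traceSpace H w) : |τ g| ≤ n := by
  obtain ⟨t1, t2, t3⟩ := hτ
  have e1 := mono_of_map_add t1 t2 h1
  have e2 := mono_of_map_add t1 t2 h2
  rw [map_nsmul_of_map_add t1, t3, mul_one] at e1 e2
  rw [← zero_sub, map_sub_of_map_add t1, map_zero_of_map_add t1] at e2
  rw [abs_le]
  constructor <;> linarith

/-- The trace space is compact. -/
theorem isCompact_traceSpace {w : H} (hw : IsOrderUnit w) : IsCompact (traceSpace H w) := by
  choose n hn1 hn2 using hw.exists_abs_le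
  refine (isCompact_univ_pi fun g : H => isCompact_Icc (a := -(n g : ℝ)) (b := n g)).of_isClosed_subset
    ?_ fun τ hτ g _ => abs_le.1 (abs_le_of_mem_traceSpace (hn1 g) (hn2 g) hτ)
  have : traceSpace H w = (⋂ a, ⋂ b, {τ : H → ℝ | τ (a + b) = τ a + τ b}) ∩
      ((⋂ g, ⋂ (_ : 0 ≤ g), {τ : H → ℝ | 0 ≤ τ g}) ∩ {τ : H → ℝ | τ w = 1}) := by
    ext τ
    simp [traceSpace]
  rw [this]
  refine IsClosed.inter ?_ (IsClosed.inter ?_ ?_)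
  · exact isClosed_iInter fun a => isClosed_iInter fun b => isClosed_eq (by fun_prop) (by fun_prop)
  · exact isClosed_iInter fun a => isClosed_iInter fun _ => isClosed_le (by fun_prop) (by fun_prop)
  · exact isClosed_eq (by fun_prop) (by fun_prop)

/-- A bound on the pure traces is a bound on all traces. -/
theorem abs_le_of_forall_pureTraces {w : H} (hw : IsOrderUnit w) {g : H} {r : ℝ}
    (h : ∀ τ ∈ pureTraces H w, |τ g| ≤ r) {τ : H → ℝ} (hτ : τ ∈ traceSpace H w) : |τ g| ≤ r := by
  have hK := closure_convexHull_extremePoints (isCompact_traceSpace hw) (convex_traceSpace w)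
  rw [← hK] at hτ
  have hconv : Convex ℝ {σ : H → ℝ | |σ g| ≤ r} := by
    have : {σ : H → ℝ | |σ g| ≤ r} = (LinearMap.proj g : (H → ℝ) →ₗ[ℝ] ℝ) ⁻¹' Set.Icc (-r) r := by
      ext σ
      simp [abs_le]
    rw [this]
    exact (convex_Icc _ _).linear_preimage _
  have hcl : IsClosed {σ : H → ℝ | |σ g| ≤ r} := isClosed_le (by fun_prop) continuous_const
  exact closure_minimal (convexHull_min h hconv) hcl hτ

theorem bddAbove_abs_traceSpace {w : H} (hw : IsOrderUnit w) (g : H) :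
    BddAbove (Set.range fun τ : traceSpace H w => |(τ : H → ℝ) g|) := by
  obtain ⟨n, h1, h2⟩ := hw.exists_abs_le g
  exact ⟨n, by rintro _ ⟨τ, rfl⟩; exact abs_le_of_mem_traceSpace h1 h2 τ.2⟩

end RieszGroups

/-! ### Integral spans of linearly independent vectors. -/

section Lattices

/-- Finitely many integral combinations of `B` use only finitely many elements of `B`. -/
theorem exists_finset_subset_span_int {V : Type*} [AddCommGroup V] {B s : Set V}
    (hs : s.Finite)
    (h : s ⊆ Submodule.span ℤ B) : ∃ F : Finset V, (F : Set V) ⊆ B ∧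
      s ⊆ Submodule.span ℤ (F : Set V) := by
  classical
  induction s, hs using Set.Finite.induction_on with
  | empty => exact ⟨∅, by simp, by simp⟩
  | @insert a s _ _ ih =>
    obtain ⟨F, hF, hsF⟩ := ih ((Set.subset_insert a s).trans h)
    obtain ⟨T, hT, haT⟩ := Submodule.mem_span_finite_of_mem_span (h (Set.mem_insert a s))
    refine ⟨F ∪ T, by simp [hF, hT], Set.insert_subset ?_ (hsF.trans ?_)⟩
    · exact Submodule.span_mono (by simp) haT
    · exact Submodule.span_mono (by simp)

variable {V : Type*} [NormedAddCommGroup V] [NormedSpace ℝ V] {B : Set V}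

/-- An integral combination of `B` in the real span of a subset of the `ℝ`-linearly independent
set `B` is an integral combination of that subset. -/
theorem LinearIndepOn.mem_span_int_of_mem_span_real (hB : LinearIndepOn ℝ id B) {B₀ : Set V}
    (hB₀ : B₀ ⊆ B) {x : V} (hx : x ∈ Submodule.span ℤ B) (hx' : x ∈ Submodule.span ℝ B₀) :
    x ∈ Submodule.span ℤ B₀ := by
  rw [← Set.image_id B, Finsupp.mem_span_image_iff_linearCombination] at hx
  rw [← Set.image_id B₀, Finsupp.mem_span_image_iff_linearCombination] at hx' ⊢
  obtain ⟨l, hl, rfl⟩ := hx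
  obtain ⟨l', hl', h⟩ := hx'
  refine ⟨l, ?_, rfl⟩
  have e : Finsupp.linearCombination ℝ (id : V → V) (l.mapRange (Int.cast : ℤ → ℝ) Int.cast_zero) =
      Finsupp.linearCombination ℤ id l := by
    simp only [Finsupp.linearCombination_apply]
    rw [Finsupp.sum_mapRange_index (by simp)]
    exact Finsupp.sum_congr fun v _ => Int.cast_smul_eq_zsmul ℝ _ _
  have hs : l.mapRange (Int.cast : ℤ → ℝ) Int.cast_zero ∈ Finsupp.supported ℝ ℝ B := by
    rw [Finsupp.mem_supported] at hl ⊢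
    exact (Finset.coe_subset.2 Finsupp.support_mapRange).trans hl
  -- Coordinates over `B` are unique, so the integral coordinates vanish wherever the real ones do.
  have heq := linearIndepOn_iffₛ.1 hB _ hs _ (Finsupp.supported_mono hB₀ hl') (e.trans h.symm)
  rw [Finsupp.mem_supported] at hl' ⊢
  intro v hv
  apply hl'
  simp only [Finset.mem_coe, Finsupp.mem_support_iff, ← heq, Finsupp.mapRange_apply] at hv ⊢
  exact_mod_cast hv

/-- The integral span of finitely many `ℝ`-linearly independent vectors is uniformly discrete. -/
theorem LinearIndepOn.exists_pos_le_norm {F : Finset V} (hF : LinearIndepOn ℝ id (F : Set V)) :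
    ∃ ε > 0, ∀ x ∈ Submodule.span ℤ (F : Set V), x ≠ 0 → ε ≤ ‖x‖ := by
  -- An injective linear map on a finite-dimensional space is bounded below, and a nonzero integer
  -- vector has sup norm at least `1`.
  obtain ⟨k, hk, hanti⟩ := LinearMap.exists_antilipschitzWith
    (Fintype.linearCombination ℝ (fun i : F => (i : V)))
    (LinearMap.ker_eq_bot.2 (LinearIndependent.fintypeLinearCombination_injective hF))
  refine ⟨(k : ℝ)⁻¹, by positivity, fun x hx hx0 => ?_⟩
  have hx1 : x ∈ Submodule.span ℤ (Set.range fun i : F => (i : V)) := by simpa using hx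
  obtain ⟨c, rfl⟩ := (Submodule.mem_span_range_iff_exists_fun ℤ).1 hx1
  have hc : ∃ i, c i ≠ 0 := by
    by_contra! hc
    exact hx0 (by simp [hc])
  obtain ⟨i, hi⟩ := hc
  have e : Fintype.linearCombination ℝ (fun i : F => (i : V)) (fun i => (c i : ℝ)) =
      ∑ i, c i • (i : V) := by
    simp only [Fintype.linearCombination_apply, Int.cast_smul_eq_zsmul]
  have h1 := hanti.le_mul_dist (fun i => (c i : ℝ)) 0
  rw [map_zero, dist_zero_right, dist_zero_right, e] at h1
  have h2 : (1 : ℝ) ≤ ‖fun i => (c i : ℝ)‖ := by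
    refine le_trans ?_ (norm_le_pi_norm (fun i => (c i : ℝ)) i)
    rw [Real.norm_eq_abs]
    exact_mod_cast Int.one_le_abs hi
  rw [inv_le_iff_one_le_mul₀ (by positivity), mul_comm]
  exact h2.trans h1

end Lattices

/-! ### Continuous homomorphisms out of pro-finite dimensional groups. -/

section Rigidity

variable {H : Type*} [AddCommGroup H] [PartialOrder H] [IsOrderedAddMonoid H]

/-- The element `g` is an approximate multiple of small elements. -/
theorem IsDimensionGroup.exists_approx_div (hH : IsDimensionGroup H) {w : H} (hw : IsOrderUnit w)
    (hw' : IsApproximatelyDivisible H w) (hfin : (pureTraces H w).Finite) {δ M : ℝ} (hδ : 0 < δ)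
    {m : ℕ} (hm : 0 < m) (hM : M < m * (δ / 2)) (g : H) (hg : ∀ τ ∈ pureTraces H w, |τ g| ≤ M) :
    ∃ g' : H, (∀ τ ∈ pureTraces H w, |τ g'| < δ) ∧ ∀ τ ∈ pureTraces H w, |τ (g - m • g')| < δ := by
  have hm' : (0 : ℝ) < m := by exact_mod_cast hm
  have hm1 : (1 : ℝ) ≤ m := by exact_mod_cast hm
  -- The tolerance `δ / (2m)` survives multiplication by `m`, and `hM` makes the targets `τ g / m`
  -- smaller than `δ / 2`.
  obtain ⟨g', hg'⟩ := hH.exists_approx hw hw' hfin.toFinset (fun ρ h => hfin.mem_toFinset.1 h)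
    (fun ρ => ρ g / m) (ε := δ / 2 / m) (by positivity)
  have e : δ / 2 / m * m = δ / 2 := by field_simp
  refine ⟨g', fun τ hτ => ?_, fun τ hτ => ?_⟩
  · have h1 := hg' τ (hfin.mem_toFinset.2 hτ)
    have h2 : |τ g / m| < δ / 2 := by
      rw [abs_div, abs_of_pos hm', div_lt_iff₀ hm', mul_comm]
      exact (hg τ hτ).trans_lt hM
    have h3 : δ / 2 / m ≤ δ / 2 := div_le_self (by positivity) hm1
    calc |τ g'| = |(τ g' - τ g / m) + τ g / m| := by congr 1; ring
      _ ≤ _ := abs_add_le _ _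
      _ < δ := by linarith
  · have h1 := hg' τ (hfin.mem_toFinset.2 hτ)
    rw [map_sub_of_map_add hτ.1.1, map_nsmul_of_map_add hτ.1.1]
    calc |τ g - m * τ g'| = |τ g' - τ g / m| * m := by
          rw [← abs_of_pos hm', ← abs_mul, abs_of_pos hm', abs_sub_comm]
          congr 1
          field_simp
      _ < δ / 2 / m * m := by gcongr
      _ < δ := by linarith

variable {V : Type*} [NormedAddCommGroup V]

/-- A homomorphism into a normed space that is continuous for finitely many pure traces is bounded
on bounded sets. -/
theorem IsDimensionGroup.exists_bound (hH : IsDimensionGroup H) {w : H} (hw : IsOrderUnit w)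
    (hw' : IsApproximatelyDivisible H w) (hfin : (pureTraces H w).Finite) {ψ : H →+ V}
    (hψ : ∀ ε > 0, ∃ δ > 0, ∀ g : H, (∀ τ ∈ pureTraces H w, |τ g| < δ) → ‖ψ g‖ < ε) (M : ℝ) :
    ∃ C : ℝ, ∀ g : H, (∀ τ ∈ pureTraces H w, |τ g| ≤ M) → ‖ψ g‖ ≤ C := by
  obtain ⟨δ, hδ, hδ'⟩ := hψ 1 one_pos
  -- `m` depends on `M` and `δ` but not on `g`, so the bound `1 + m` is uniform.
  obtain ⟨m, hm⟩ := exists_nat_gt (max 0 (M / (δ / 2)))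
  have hm0 : 0 < m := by exact_mod_cast (le_max_left _ _).trans_lt hm
  have hmM : M < m * (δ / 2) := (div_lt_iff₀ (by positivity)).1 ((le_max_right _ _).trans_lt hm)
  refine ⟨1 + m, fun g hg => ?_⟩
  obtain ⟨g', h1, h2⟩ := hH.exists_approx_div hw hw' hfin hδ hm0 hmM g hg
  have e : ψ g = ψ (g - m • g') + m • ψ g' := by simp
  rw [e]
  refine (norm_add_le _ _).trans (add_le_add (hδ' _ h2).le ?_)
  refine (norm_nsmul_le).trans ?_
  calc (m : ℝ) * ‖ψ g'‖ ≤ m * 1 := by gcongr; exact (hδ' _ h1).le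
    _ = m := mul_one _

variable [NormedSpace ℝ V]

/-- A homomorphism into a normed space that is continuous for finitely many pure traces has range
in a finite-dimensional subspace. -/
theorem IsDimensionGroup.exists_finite_range_subset (hH : IsDimensionGroup H) {w : H}
    (hw : IsOrderUnit w) (hw' : IsApproximatelyDivisible H w) (hfin : (pureTraces H w).Finite)
    {ψ : H →+ V}
    (hψ : ∀ ε > 0, ∃ δ > 0, ∀ g : H, (∀ τ ∈ pureTraces H w, |τ g| < δ) → ‖ψ g‖ < ε) :
    ∃ s : Set H, s.Finite ∧ ∀ g, ψ g ∈ Submodule.span ℝ (ψ '' s) := by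
  have : Fintype (pureTraces H w) := hfin.fintype
  let ρ : H → pureTraces H w → ℝ := fun g τ => τ.1 g
  -- A dense image spans, since subspaces of `ℝⁿ` are closed.
  have hspan : Submodule.span ℝ (Set.range ρ) = ⊤ := by
    have hcl : IsClosed (Submodule.span ℝ (Set.range ρ) : Set (pureTraces H w → ℝ)) :=
      Submodule.closed_of_finiteDimensional _
    rw [← Submodule.coe_eq_univ, ← hcl.closure_eq]
    refine Dense.closure_eq (Dense.mono Submodule.subset_span ?_)
    rw [Metric.dense_iff]
    intro t r hr
    classical
    obtain ⟨g, hg⟩ := hH.exists_approx hw hw' hfin.toFinset (fun ρ h => hfin.mem_toFinset.1 h)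
      (fun σ => if h : σ ∈ pureTraces H w then t ⟨σ, h⟩ else 0) hr
    refine ⟨ρ g, ?_, g, rfl⟩
    rw [Metric.mem_ball, dist_pi_lt_iff hr]
    intro τ
    simpa [ρ, Real.dist_eq] using hg τ.1 (hfin.mem_toFinset.2 τ.2)
  obtain ⟨f, hf, hf', -⟩ := Submodule.exists_fun_fin_finrank_span_eq ℝ (Set.range ρ)
  choose p hp using hf
  refine ⟨Set.range p, Set.finite_range p, fun g => ?_⟩
  have hgmem : ρ g ∈ Submodule.span ℝ (Set.range f) := by rw [hf', hspan]; trivial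
  obtain ⟨c, hc⟩ := (Submodule.mem_span_range_iff_exists_fun ℝ).1 hgmem
  set W := Submodule.span ℝ (ψ '' Set.range p)
  have hfd : FiniteDimensional ℝ W :=
    FiniteDimensional.span_of_finite ℝ ((Set.finite_range p).image ψ)
  have hWcl : IsClosed (W : Set V) := Submodule.closed_of_finiteDimensional W
  obtain ⟨M, hM⟩ : ∃ M, ∀ τ ∈ pureTraces H w, (∑ i, |τ (p i)|) ≤ M := by
    obtain ⟨M, hM⟩ := (hfin.image fun τ => ∑ i, |τ (p i)|).bddAbove
    exact ⟨M, fun τ hτ => hM ⟨τ, hτ, rfl⟩⟩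
  obtain ⟨C, hC⟩ := hH.exists_bound hw hw' hfin hψ M
  change ψ g ∈ (W : Set V)
  rw [← hWcl.closure_eq, Metric.mem_closure_iff]
  intro ε hε
  -- Rounding the real coordinates `N * c i` of `N • g` leaves a remainder whose traces are bounded
  -- by `M` for every `N`. Its image has norm at most `C`, so `ψ g` is within `C / N` of the closed
  -- subspace `W`.
  obtain ⟨N, hN⟩ := exists_nat_gt (max 0 (C / ε))
  have hN0 : (0 : ℝ) < N := (le_max_left _ _).trans_lt hN
  have hNC : C < N * ε := (div_lt_iff₀ hε).1 ((le_max_right _ _).trans_lt hN)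
  refine ⟨(N : ℝ)⁻¹ • ∑ i, ⌊N * c i⌋ • ψ (p i), ?_, ?_⟩
  · refine W.smul_mem _ (W.sum_mem fun i _ => ?_)
    rw [← Int.cast_smul_eq_zsmul ℝ]
    exact W.smul_mem _ (Submodule.subset_span ⟨p i, ⟨i, rfl⟩, rfl⟩)
  · have hb : ‖ψ (N • g - ∑ i, ⌊N * c i⌋ • p i)‖ ≤ C := by
      refine hC _ fun τ hτ => le_trans ?_ (hM τ hτ)
      have e1 : τ g = ∑ i, c i * τ (p i) := by
        have := congrFun hc ⟨τ, hτ⟩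
        rw [Finset.sum_apply] at this
        simp only [Pi.smul_apply, smul_eq_mul, ← hp, ρ] at this
        exact this.symm
      rw [map_sub_of_map_add hτ.1.1, map_nsmul_of_map_add hτ.1.1, map_sum_of_map_add hτ.1.1, e1,
        Finset.mul_sum, ← Finset.sum_sub_distrib]
      refine (Finset.abs_sum_le_sum_abs _ _).trans (Finset.sum_le_sum fun i _ => ?_)
      rw [map_zsmul_of_map_add hτ.1.1, ← mul_assoc, ← sub_mul, abs_mul]
      refine mul_le_of_le_one_left (abs_nonneg _) ?_
      have h1 := Int.floor_le (N * c i)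
      have h2 := Int.lt_floor_add_one (N * c i)
      rw [abs_le]
      constructor <;> linarith
    have e : ψ g - (N : ℝ)⁻¹ • ∑ i, ⌊N * c i⌋ • ψ (p i) =
        (N : ℝ)⁻¹ • ψ (N • g - ∑ i, ⌊N * c i⌋ • p i) := by
      simp only [map_sub, map_nsmul, map_sum, map_zsmul, smul_sub]
      rw [← Nat.cast_smul_eq_nsmul ℝ, smul_smul, inv_mul_cancel₀ hN0.ne', one_smul]
    rw [dist_eq_norm, e, norm_smul, norm_inv, Real.norm_natCast, inv_mul_lt_iff₀ hN0]
    exact hb.trans_lt hNC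

/-- A homomorphism from an approximately divisible dimension group with finitely many pure traces
to the integral span of an `ℝ`-linearly independent set is zero if it is continuous. -/
theorem IsDimensionGroup.eq_zero_of_mem_span_int (hH : IsDimensionGroup H) {w : H}
    (hw : IsOrderUnit w) (hw' : IsApproximatelyDivisible H w) (hfin : (pureTraces H w).Finite)
    {ψ : H →+ V}
    (hψ : ∀ ε > 0, ∃ δ > 0, ∀ g : H, (∀ τ ∈ pureTraces H w, |τ g| < δ) → ‖ψ g‖ < ε)
    {B : Set V} (hB : LinearIndepOn ℝ id B) (hψB : ∀ g, ψ g ∈ Submodule.span ℤ B) (g : H) :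
    ψ g = 0 := by
  obtain ⟨s, hs, hspan⟩ := hH.exists_finite_range_subset hw hw' hfin hψ
  obtain ⟨F, hFB, hsF⟩ := exists_finset_subset_span_int (hs.image ψ)
    (by rintro _ ⟨h, -, rfl⟩; exact hψB h)
  have hmem : ∀ h, ψ h ∈ Submodule.span ℤ (F : Set V) := fun h =>
    hB.mem_span_int_of_mem_span_real hFB (hψB h)
      (Submodule.span_le.2 (hsF.trans (Submodule.span_subset_span ℤ ℝ _)) (hspan h))
  obtain ⟨ε, hε, hdisc⟩ := (hB.mono hFB).exists_pos_le_norm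
  obtain ⟨δ, hδ, hδ'⟩ := hψ ε hε
  -- Values of norm less than `ε` in the lattice spanned by `F` are zero.
  have hsmall : ∀ h, (∀ τ ∈ pureTraces H w, |τ h| < δ) → ψ h = 0 := fun h hh => by
    by_contra h0
    exact absurd (hδ' h hh) (not_lt.2 (hdisc _ (hmem h) h0))
  obtain ⟨n, h1, h2⟩ := hw.exists_abs_le g
  obtain ⟨m, hm⟩ := exists_nat_gt (max 0 ((n : ℝ) / (δ / 2)))
  have hm0 : 0 < m := by exact_mod_cast (le_max_left _ _).trans_lt hm
  have hmM : (n : ℝ) < m * (δ / 2) :=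
    (div_lt_iff₀ (by positivity)).1 ((le_max_right _ _).trans_lt hm)
  obtain ⟨g', h3, h4⟩ := hH.exists_approx_div hw hw' hfin hδ hm0 hmM g
    fun τ hτ => abs_le_of_mem_traceSpace h1 h2 hτ.1
  have e : ψ g = ψ (g - m • g') + m • ψ g' := by simp
  rw [e, hsmall _ h4, hsmall _ h3, smul_zero, add_zero]

/-- A homomorphism from a pro-finite dimensional dimension group to the integral span of an
`ℝ`-linearly independent set is zero if it is continuous. -/
theorem IsProFD.eq_zero_of_mem_span_int {H : Type v} [AddCommGroup H] [PartialOrder H]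
    [IsOrderedAddMonoid H] (hH : IsProFD H) {w : H} (hw : IsOrderUnit w) {ψ : H →+ V}
    (hψ : ∀ ε > 0, ∃ δ > 0, ∀ g : H, traceNorm w g < δ → ‖ψ g‖ < ε)
    {B : Set V} (hB : LinearIndepOn ℝ id B) (hψB : ∀ g, ψ g ∈ Submodule.span ℤ B) (x : H) :
    ψ x = 0 := by
  obtain ⟨-, ⟨P⟩⟩ := hH
  obtain ⟨i, g, rfl⟩ := P.exists_toLimit x
  let := P.addCommGroup i
  let := P.partialOrder i
  have := P.isOrderedAddMonoid i
  let L : P.obj i →+o H := P.toLimit i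
  obtain ⟨n, hn⟩ := hw.2 (L (P.unit i))
  -- A trace of `H` pulls back to a positive functional on the stage, of value at most `n` at its
  -- unit. If that value is `0` the functional vanishes; otherwise it is a multiple of a trace.
  have hbound : ∀ r > 0, ∀ g : P.obj i, (∀ τ ∈ pureTraces (P.obj i) (P.unit i), |τ g| ≤ r) →
      traceNorm w (L g) ≤ n * r := by
    intro r hr g hg
    refine traceNorm_le (by positivity) fun σ hσ => ?_
    obtain ⟨s1, s2, s3⟩ := hσ
    have hadd : ∀ a b, σ (L (a + b)) = σ (L a) + σ (L b) := fun a b => by rw [map_add, s1]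
    have hpos : ∀ a : P.obj i, 0 ≤ a → 0 ≤ σ (L a) := fun a ha => s2 _ (map_nonneg L ha)
    have hcn : σ (L (P.unit i)) ≤ n := by
      have := mono_of_map_add s1 s2 hn
      rwa [map_nsmul_of_map_add s1, s3, mul_one] at this
    have hc0 := hpos _ (P.isOrderUnit i).1
    rcases hc0.eq_or_lt with hc | hc
    · obtain ⟨m, h1, h2⟩ := (P.isOrderUnit i).exists_abs_le g
      have e1 := mono_of_map_add (τ := fun a => σ (L a)) hadd hpos h1
      have e2 := mono_of_map_add (τ := fun a => σ (L a)) hadd hpos h2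
      have e3 := map_nsmul_of_map_add (τ := fun a => σ (L a)) hadd m (P.unit i)
      have e4 := map_sub_of_map_add (τ := fun a => σ (L a)) hadd 0 g
      have e5 := map_zero_of_map_add (τ := fun a => σ (L a)) hadd
      rw [← hc, mul_zero] at e3
      rw [zero_sub] at e4
      have : σ (L g) = 0 := by linarith
      rw [this, abs_zero]
      positivity
    · have hmem : (fun a => (σ (L (P.unit i)))⁻¹ * σ (L a)) ∈ traceSpace (P.obj i) (P.unit i) :=
        ⟨fun a b => by simp only [hadd]; ring, fun a ha => by have := hpos a ha; positivity,
          inv_mul_cancel₀ hc.ne'⟩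
      have := abs_le_of_forall_pureTraces (P.isOrderUnit i) hg hmem
      rw [abs_mul, abs_inv, abs_of_pos hc, inv_mul_le_iff₀ hc] at this
      exact this.trans (by gcongr)
  refine (P.isDimensionGroup i).eq_zero_of_mem_span_int (P.isOrderUnit i) (P.approxDivisible i)
    (P.finite_pureTraces i) (ψ := ψ.comp (L : P.obj i →+ H)) (fun ε hε => ?_) hB
    (fun g => hψB _) g
  obtain ⟨δ, hδ, hδ'⟩ := hψ ε hε
  refine ⟨δ / (n + 1), by positivity, fun g hg => hδ' _ ?_⟩
  refine (hbound (δ / (n + 1)) (by positivity) g fun τ hτ => (hg τ hτ).le).trans_lt ?_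
  rw [← mul_div_assoc, div_lt_iff₀ (by positivity)]
  nlinarith

end Rigidity

/-! ### A dense linearly independent set. -/

section DenseIndependent

variable {V : Type*} [NormedAddCommGroup V] [NormedSpace ℝ V]

/-- In an infinite-dimensional separable normed space, a nonzero vector belongs to a countable
dense linearly independent set. -/
theorem exists_countable_dense_linearIndepOn [SecondCountableTopology V]
    (hV : ¬ FiniteDimensional ℝ V) {e : V} (he : e ≠ 0) :
    ∃ B : Set V, B.Countable ∧ Dense B ∧ LinearIndepOn ℝ id B ∧ e ∈ B := by
  classical
  have step : ∀ (F : Finset V) (U : Set V), IsOpen U → U.Nonempty →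
      LinearIndepOn ℝ id (F : Set V) →
      ∃ F' : Finset V, F ⊆ F' ∧ LinearIndepOn ℝ id (F' : Set V) ∧ ((F' : Set V) ∩ U).Nonempty := by
    intro F U hU hne hF
    -- A subspace with nonempty interior is the whole space, which is not spanned by finitely many
    -- vectors.
    have : ∃ x ∈ U, x ∉ Submodule.span ℝ (F : Set V) := by
      by_contra! hcon
      have hint : (interior (Submodule.span ℝ (F : Set V) : Set V)).Nonempty :=
        hne.mono (interior_maximal hcon hU)
      apply hV
      have htop := Submodule.eq_top_of_nonempty_interior' _ hint
      exact ⟨⟨F, htop⟩⟩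
    obtain ⟨x, hxU, hx⟩ := this
    refine ⟨insert x F, Finset.subset_insert x F, ?_, x, by simp, hxU⟩
    rw [Finset.coe_insert]
    exact hF.insert (by simpa using hx)
  choose! next hn1 hn2 hn3 using step
  have hbasis : (TopologicalSpace.countableBasis V).Nonempty := by
    by_contra hne
    have := (TopologicalSpace.isBasis_countableBasis V).sUnion_eq
    rw [Set.not_nonempty_iff_eq_empty.1 hne, Set.sUnion_empty] at this
    exact Set.empty_ne_univ this
  obtain ⟨U, hU⟩ := (TopologicalSpace.countable_countableBasis V).exists_eq_range hbasis
  have hUo : ∀ n, IsOpen (U n) := fun n =>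
    TopologicalSpace.isOpen_of_mem_countableBasis (by rw [hU]; exact ⟨n, rfl⟩)
  have hUne : ∀ n, (U n).Nonempty := fun n =>
    TopologicalSpace.nonempty_of_mem_countableBasis (by rw [hU]; exact ⟨n, rfl⟩)
  obtain ⟨S, hS0, hS1⟩ : ∃ S : ℕ → Finset V, S 0 = {e} ∧ ∀ n, S (n + 1) = next (S n) (U n) :=
    ⟨Nat.rec {e} fun n F => next F (U n), rfl, fun _ => rfl⟩
  have hS : ∀ n, LinearIndepOn ℝ id (S n : Set V) := by
    intro n
    induction n with
    | zero => simpa [hS0] using he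
    | succ n ih =>
      rw [hS1]
      exact hn2 (S n) (U n) (hUo n) (hUne n) ih
  have hmono : Monotone fun n => (S n : Set V) :=
    monotone_nat_of_le_succ fun n =>
      Finset.coe_subset.2 (hS1 n ▸ hn1 (S n) (U n) (hUo n) (hUne n) (hS n))
  refine ⟨⋃ n, (S n : Set V), Set.countable_iUnion fun n => (S n).countable_toSet, ?_,
    linearIndepOn_iUnion_of_directed (η := ℕ) (s := fun n => (S n : Set V)) hmono.directed_le hS, Set.mem_iUnion.2 ⟨0, by simp [hS0]⟩⟩
  rw [(TopologicalSpace.isBasis_countableBasis V).dense_iff]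
  intro o ho _
  rw [hU] at ho
  obtain ⟨n, rfl⟩ := ho
  obtain ⟨x, hx, hxU⟩ := hn3 (S n) (U n) (hUo n) (hUne n) (hS n)
  exact ⟨x, hxU, Set.mem_iUnion.2 ⟨n + 1, hS1 n ▸ hx⟩⟩

end DenseIndependent

/-! ### The cone over a convex set. -/

section Cones

/-- Riesz refinement in a lattice cone. -/
theorem IsLatticeCone.refinement {V : Type*} [AddCommGroup V] {C : Set V} (hC : IsLatticeCone C)
    (hadd : ∀ a ∈ C, ∀ b ∈ C, a + b ∈ C) {a b c d : V} (ha : a ∈ C) (hb : b ∈ C) (hc : c ∈ C)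
    (hd : d ∈ C) (h : a + b = c + d) :
    ∃ p ∈ C, ∃ q ∈ C, ∃ r ∈ C, ∃ s ∈ C, a = p + q ∧ b = r + s ∧ c = p + r ∧ d = q + s := by
  -- With `s = a ∨ c`, the refinement is `a + c - s` (playing the role of `a ∧ c`), `s - c`, `s - a`
  -- and `a + b - s`; `e1` and `e2` hold because `a + c` and `a + b` dominate both `a` and `c`.
  obtain ⟨⟨s, -, hsa, hsc, hs⟩, -⟩ := hC a ha c hc
  have e1 := hs (a + c) (hadd a ha c hc) (by simpa using hc) (by simpa using ha)
  have e2 := hs (a + b) (hadd a ha b hb) (by simpa using hb) (by rw [h]; simpa using hd)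
  refine ⟨_, e1, _, hsc, _, hsa, _, e2, by abel, by abel, by abel, ?_⟩
  rw [h]
  abel

variable {E : Type u} [AddCommGroup E] [Module ℝ E] {K : Set E}

theorem mem_coneOver {t : ℝ} (ht : 0 ≤ t) {x : E} (hx : x ∈ K) : (t, t • x) ∈ coneOver K :=
  ⟨t, ht, x, hx, rfl⟩

theorem exists_coneOver_add (hK : Convex ℝ K) {s t : ℝ} (hs : 0 ≤ s) (ht : 0 ≤ t)
    (hst : 0 < s + t) {x y : E} (hx : x ∈ K) (hy : y ∈ K) :
    ∃ z ∈ K, z = (s / (s + t)) • x + (t / (s + t)) • y ∧ (s + t) • z = s • x + t • y := by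
  refine ⟨_, hK hx hy (div_nonneg hs hst.le) (div_nonneg ht hst.le) (by field_simp), rfl, ?_⟩
  rw [smul_add, smul_smul, smul_smul, mul_div_cancel₀ _ hst.ne', mul_div_cancel₀ _ hst.ne']

theorem add_mem_coneOver (hK : Convex ℝ K) {p q : ℝ × E} (hp : p ∈ coneOver K)
    (hq : q ∈ coneOver K) : p + q ∈ coneOver K := by
  obtain ⟨s, hs, x, hx, rfl⟩ := hp
  obtain ⟨t, ht, y, hy, rfl⟩ := hq
  rcases (add_nonneg hs ht).eq_or_lt with h | h
  · have hs0 : s = 0 := by linarith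
    have ht0 : t = 0 := by linarith
    exact ⟨0, le_rfl, x, hx, by simp [hs0, ht0]⟩
  · obtain ⟨z, hz, -, hz'⟩ := exists_coneOver_add hK hs ht h hx hy
    exact ⟨s + t, h.le, z, hz, by rw [hz']; rfl⟩

variable [TopologicalSpace E]

open Classical in
/-- The homogeneous extension of a function on `K` to the cone over `K`. -/
noncomputable def coneEval (f : C(K, ℝ)) (p : ℝ × E) : ℝ :=
  if h : p.1⁻¹ • p.2 ∈ K then p.1 * f ⟨p.1⁻¹ • p.2, h⟩ else 0

theorem coneEval_mk (f : C(K, ℝ)) (t : ℝ) (x : K) : coneEval f (t, t • (x : E)) = t * f x := by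
  -- At the apex both branches of `coneEval` give `0`, whether or not `0 ∈ K`.
  by_cases ht : t = 0
  · simp [coneEval, ht]
  · simp [coneEval, inv_smul_smul₀ ht]

theorem coneEval_add (hK : Convex ℝ K) (f : AffineFunctions K) {p q : ℝ × E}
    (hp : p ∈ coneOver K) (hq : q ∈ coneOver K) :
    coneEval f.1 (p + q) = coneEval f.1 p + coneEval f.1 q := by
  obtain ⟨s, hs, x, hx, rfl⟩ := hp
  obtain ⟨t, ht, y, hy, rfl⟩ := hq
  rw [coneEval_mk f.1 s ⟨x, hx⟩, coneEval_mk f.1 t ⟨y, hy⟩]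
  rcases (add_nonneg hs ht).eq_or_lt with h | h
  · have hs0 : s = 0 := by linarith
    have ht0 : t = 0 := by linarith
    simp [hs0, ht0, coneEval]
  · obtain ⟨z, hz, hz1, hz2⟩ := exists_coneOver_add hK hs ht h hx hy
    have e : (s, s • x) + (t, t • y) = (s + t, (s + t) • z) := by rw [hz2]; rfl
    rw [e, coneEval_mk f.1 (s + t) ⟨z, hz⟩, f.2 ⟨x, hx⟩ ⟨y, hy⟩ ⟨z, hz⟩ _ _
      (div_nonneg hs h.le) (div_nonneg ht h.le) (by field_simp) hz1]
    field_simp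

theorem coneEval_mono {f g : C(K, ℝ)} (h : ∀ x, f x ≤ g x) {p : ℝ × E} (hp : p ∈ coneOver K) :
    coneEval f p ≤ coneEval g p := by
  obtain ⟨t, ht, x, hx, rfl⟩ := hp
  rw [coneEval_mk f t ⟨x, hx⟩, coneEval_mk g t ⟨x, hx⟩]
  exact mul_le_mul_of_nonneg_left (h _) ht

end Cones

/-! ### Continuous affine functions: positive functionals and interpolation. -/

section AffineFunctions

theorem ContinuousMap.exists_pos_add_le {K : Type*} [TopologicalSpace K] [CompactSpace K]
    {f g : C(K, ℝ)} (h : ∀ x, f x < g x) :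
    ∃ ε > 0, ∀ x, f x + ε ≤ g x := by
  rcases isEmpty_or_nonempty K with hK | hK
  · exact ⟨1, one_pos, fun x => hK.elim x⟩
  · obtain ⟨x, -, hx⟩ := isCompact_univ.exists_isMinOn Set.univ_nonempty
      (g - f).continuous.continuousOn
    refine ⟨g x - f x, sub_pos.2 (h x), fun y => ?_⟩
    have : g x - f x ≤ g y - f y := hx (Set.mem_univ y)
    linarith

variable {E : Type u} [AddCommGroup E] [Module ℝ E] [TopologicalSpace E] {K : Set E}

namespace AffineFunctions

variable (K) in
/-- Constant functions are affine. -/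
def const (r : ℝ) : AffineFunctions K :=
  ⟨ContinuousMap.const K r, fun _ _ _ a b _ _ hab _ => by
    simp only [ContinuousMap.const_apply]
    rw [← add_mul, hab, one_mul]⟩

@[simp]
theorem const_apply (r : ℝ) (x : K) : (const K r).1 x = r := rfl

theorem coe_zsmul_apply (n : ℤ) (f : AffineFunctions K) (x : K) : (n • f).1 x = n * f.1 x := by
  simp

theorem coe_sum_apply {ι : Type*} (s : Finset ι) (f : ι → AffineFunctions K) (x : K) :
    (∑ i ∈ s, f i).1 x = ∑ i ∈ s, (f i).1 x := by
  simp

theorem isOpen_setOf_forall_lt [CompactSpace K] (f : AffineFunctions K) :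
    IsOpen {g : AffineFunctions K | ∀ x, f.1 x < g.1 x} := by
  have h1 : IsOpen {g : C(K, ℝ) | Set.MapsTo g Set.univ (Set.Ioi 0)} :=
    ContinuousMap.isOpen_setOfPred_mapsTo isCompact_univ isOpen_Ioi
  have h2 : Continuous fun g : AffineFunctions K => g.1 - f.1 := by fun_prop
  convert h1.preimage h2 using 1
  ext g
  simp [Set.MapsTo]

/-- A normalized positive additive functional on a group of affine functions is the evaluation at
a point of `K`. -/
theorem exists_eq_eval [CompactSpace K] (hK : Convex ℝ K) {M : Type*} [AddCommGroup M]
    (ι : M →+ AffineFunctions K) (τ : M →+ ℝ) {e : M} (he : ι e = const K 1) (hτe : τ e = 1)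
    (hpos : ∀ m, (∀ x, 0 < (ι m).1 x) → 0 ≤ τ m) : ∃ x : K, ∀ m, τ m = (ι m).1 x := by
  classical
  -- By compactness of `K` it suffices to match `τ` on finitely many elements at a time.
  have hfin : ∀ F : Finset M, (Set.univ ∩ ⋂ m ∈ F, {x : K | τ m = (ι m).1 x}).Nonempty := by
    intro F
    let Φ : K → F → ℝ := fun x m => (ι m).1 x
    have hΦ : Continuous Φ := continuous_pi fun m => (ι m).1.continuous
    have hconv : Convex ℝ (Set.range Φ) := by
      rintro _ ⟨x, rfl⟩ _ ⟨y, rfl⟩ a b ha hb hab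
      exact ⟨⟨a • (x : E) + b • (y : E), hK x.2 y.2 ha hb hab⟩,
        funext fun m => (ι m).2 x y _ a b ha hb hab rfl⟩
    by_cases hmem : (fun m : F => τ m) ∈ Set.range Φ
    · obtain ⟨x, hx⟩ := hmem
      refine ⟨x, trivial, ?_⟩
      simp only [Set.mem_iInter]
      exact fun m hm => (congrFun hx ⟨m, hm⟩).symm
    exfalso
    obtain ⟨g, v, hv, hg⟩ := geometric_hahn_banach_point_closed hconv
      (isCompact_range hΦ).isClosed hmem
    have hg' : ∀ p : F → ℝ, g p = ∑ m, p m * g (Pi.single m 1) := by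
      intro p
      conv_lhs => rw [pi_eq_sum_univ' p]
      simp [map_sum]
    set c : F → ℝ := fun m => g (Pi.single m 1)
    obtain ⟨B, hB⟩ : ∃ B : ℝ, ∀ x, ∑ m : F, |(ι m).1 x| ≤ B := by
      obtain ⟨B, hB⟩ := (isCompact_range (f := fun x : K => ∑ m : F, |(ι m).1 x|)
        (by fun_prop)).bddAbove
      exact ⟨B, fun x => hB ⟨x, rfl⟩⟩
    set B' : ℝ := ∑ m : F, |τ m|
    have floor_est : ∀ (N : ℕ) (p : F → ℝ),
        |∑ m, ⌊N * c m⌋ * p m - N * g p| ≤ ∑ m, |p m| := by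
      intro N p
      rw [hg', Finset.mul_sum, ← Finset.sum_sub_distrib]
      refine (Finset.abs_sum_le_sum_abs _ _).trans (Finset.sum_le_sum fun m _ => ?_)
      have e : ⌊N * c m⌋ * p m - N * (p m * g (Pi.single m 1)) = (⌊N * c m⌋ - N * c m) * p m := by
        ring
      rw [e, abs_mul]
      refine mul_le_of_le_one_left (abs_nonneg _) ?_
      have h1 := Int.floor_le (N * c m)
      have h2 := Int.lt_floor_add_one (N * c m)
      rw [abs_le]
      constructor <;> linarith
    obtain ⟨N, hN⟩ := exists_nat_gt ((B + B' + 2) / (v - g fun m : F => τ m))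
    rw [div_lt_iff₀ (by linarith)] at hN
    -- The separating functional has real coefficients `c`, so `N * c` is rounded to integers. For
    -- large `N` the resulting group element is strictly positive on `K`, while `y` is an upper
    -- bound for the value of `τ` on the rounded sum, so subtracting `⌊y⌋ + 1` makes `τ` negative.
    set y : ℝ := N * g (fun m : F => τ m) + B'
    have key := hpos (∑ m : F, ⌊N * c m⌋ • (m : M) - (⌊y⌋ + 1) • e) fun x => by
      have h1 := (abs_le.1 (floor_est N (Φ x))).1
      have h2 := hg (Φ x) ⟨x, rfl⟩
      have h3 : (N : ℝ) * v ≤ N * g (Φ x) := by gcongr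
      have h4 := hB x
      have h5 := Int.floor_le y
      have e1 : (ι (∑ m : F, ⌊N * c m⌋ • (m : M) - (⌊y⌋ + 1) • e)).1 x =
          ∑ m, ⌊N * c m⌋ * Φ x m - (⌊y⌋ + 1) := by
        rw [map_sub, map_sum, map_zsmul, he]
        simp only [map_zsmul]
        change (∑ m : F, ⌊N * c m⌋ • ι m).1 x - ((⌊y⌋ + 1) • const K 1).1 x = _
        rw [coe_sum_apply, coe_zsmul_apply]
        simp only [coe_zsmul_apply, const_apply]
        push_cast
        ring
      rw [e1]
      have h6 : ∑ m, |Φ x m| ≤ B := h4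
      nlinarith
    have h1 := (abs_le.1 (floor_est N (fun m : F => τ m))).2
    have e1 : τ (∑ m : F, ⌊N * c m⌋ • (m : M) - (⌊y⌋ + 1) • e) =
        ∑ m : F, ⌊N * c m⌋ * τ m - (⌊y⌋ + 1) := by
      rw [map_sub, map_sum, map_zsmul, hτe]
      simp
    rw [e1] at key
    have h2 := Int.lt_floor_add_one y
    linarith
  obtain ⟨x, -, hx⟩ := isCompact_univ.inter_iInter_nonempty
    (fun m => {x : K | τ m = (ι m).1 x})
    (fun m => isClosed_eq continuous_const (ι m).1.continuous) hfin
  exact ⟨x, fun m => Set.mem_iInter.1 hx m⟩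

/-- Positive linear functionals are represented by points of the cone over `K`. -/
theorem exists_eq_coneEval [CompactSpace K] (hK : Convex ℝ K) (hne : K.Nonempty)
    (L : AffineFunctions K →ₗ[ℝ] ℝ) (hL : ∀ f, (∀ x, 0 ≤ f.1 x) → 0 ≤ L f) :
    ∃ p ∈ coneOver K, ∀ f : AffineFunctions K, L f = coneEval f.1 p := by
  rcases (hL (const K 1) fun x => zero_le_one).eq_or_lt with h | h
  · obtain ⟨x, hx⟩ := hne
    refine ⟨(0, (0 : ℝ) • x), mem_coneOver le_rfl hx, fun f => ?_⟩
    rw [coneEval_mk f.1 0 ⟨x, hx⟩, zero_mul]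
    have hc : ∀ r, L (const K r) = 0 := fun r => by
      have : const K r = r • const K 1 := Subtype.ext (ContinuousMap.ext fun x => by simp [const])
      rw [this, map_smul, ← h, smul_zero]
    have hf : ∀ x, |f.1 x| ≤ ‖f.1‖ := fun x => f.1.norm_coe_le_norm x
    have h1 := hL (const K ‖f.1‖ - f) fun x => sub_nonneg.2 (abs_le.1 (hf x)).2
    have h2 := hL (const K ‖f.1‖ + f) fun x => by
      change 0 ≤ ‖f.1‖ + f.1 x
      linarith [(abs_le.1 (hf x)).1]
    rw [map_sub, hc] at h1
    rw [map_add, hc] at h2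
    linarith
  · set t := L (const K 1)
    obtain ⟨x, hx⟩ := exists_eq_eval hK (AddMonoidHom.id (AffineFunctions K))
      (t⁻¹ • L).toAddMonoidHom (e := const K 1) rfl (inv_mul_cancel₀ h.ne')
      fun f hf => mul_nonneg (inv_nonneg.2 h.le) (hL f fun x => (hf x).le)
    refine ⟨_, mem_coneOver h.le x.2, fun f => ?_⟩
    rw [coneEval_mk]
    have : t⁻¹ * L f = f.1 x := hx f
    rw [← this, mul_inv_cancel_left₀ h.ne']

section LocallyConvex

variable [IsTopologicalAddGroup E] [ContinuousSMul ℝ E] [LocallyConvexSpace ℝ E] [T2Space E]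

variable (K) in
/-- Restriction of continuous linear functionals to `K`. -/
def restrict : (E →L[ℝ] ℝ) →ₗ[ℝ] AffineFunctions K where
  toFun l := ⟨⟨fun x => l x, by fun_prop⟩, fun x y z a b _ _ _ hz => by simp [hz]⟩
  map_add' _ _ := rfl
  map_smul' _ _ := rfl

theorem exists_apply_ne {x y : K} (h : x ≠ y) : ∃ f : AffineFunctions K, f.1 x ≠ f.1 y := by
  obtain ⟨l, hl⟩ := geometric_hahn_banach_point_point (x := (x : E)) (y := y)
    (fun e => h (Subtype.ext e))
  exact ⟨restrict K l, hl.ne⟩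

/-- If `K` is infinite-dimensional, then so is the space of affine functions on it. -/
theorem not_finiteDimensional (hinf : ¬ FiniteDimensional ℝ (vectorSpan ℝ K)) :
    ¬ FiniteDimensional ℝ (AffineFunctions K) := by
  intro hfd
  apply hinf
  set R := restrict K
  have hker : ∀ v ∈ vectorSpan ℝ K, ∀ l ∈ LinearMap.ker R, l v = 0 := by
    intro v hv l hl
    have hl' : ∀ x ∈ K, l x = 0 := fun x hx =>
      congrArg (fun f : AffineFunctions K => f.1 ⟨x, hx⟩) (LinearMap.mem_ker.1 hl)
    have : vectorSpan ℝ K ≤ LinearMap.ker (l : E →ₗ[ℝ] ℝ) := by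
      rw [vectorSpan_def, Submodule.span_le]
      rintro _ ⟨x, hx, y, hy, rfl⟩
      simp [hl' x hx, hl' y hy]
    exact this hv
  -- This quotient embeds in `Aff K`. By Hahn-Banach its dual separates `vectorSpan ℝ K`, which is
  -- therefore finite-dimensional too.
  have : FiniteDimensional ℝ ((E →L[ℝ] ℝ) ⧸ LinearMap.ker R) :=
    Module.Finite.equiv R.quotKerEquivRange.symm
  let T : vectorSpan ℝ K →ₗ[ℝ] Module.Dual ℝ ((E →L[ℝ] ℝ) ⧸ LinearMap.ker R) :=
    { toFun := fun v => (LinearMap.ker R).liftQ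
        { toFun := fun l => l v, map_add' := fun _ _ => rfl, map_smul' := fun _ _ => rfl }
        (fun l hl => hker v v.2 l hl)
      map_add' := fun v w => by
        ext l
        exact map_add l (v : E) w
      map_smul' := fun c v => by
        ext l
        exact map_smul l c (v : E) }
  refine FiniteDimensional.of_injective T ((injective_iff_map_eq_zero T).2 fun v hv => ?_)
  by_contra hne
  obtain ⟨l, hl⟩ := geometric_hahn_banach_point_point (x := (v : E)) (y := 0)
    (fun e => hne (Subtype.ext e))
  have : l v = 0 := by
    have := congrArg (fun g => g ((LinearMap.ker R).mkQ l)) hv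
    exact this
  rw [this, map_zero] at hl
  exact lt_irrefl _ hl

/-- Affine functions separate the points of the cone over `K`. -/
theorem eq_of_coneEval_eq {p q : ℝ × E} (hp : p ∈ coneOver K) (hq : q ∈ coneOver K)
    (h : ∀ f : AffineFunctions K, coneEval f.1 p = coneEval f.1 q) : p = q := by
  obtain ⟨s, hs, x, hx, rfl⟩ := hp
  obtain ⟨t, ht, y, hy, rfl⟩ := hq
  simp only [fun f : AffineFunctions K => coneEval_mk f.1 s ⟨x, hx⟩,
    fun f : AffineFunctions K => coneEval_mk f.1 t ⟨y, hy⟩] at h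
  have hst : s = t := by simpa using h (const K 1)
  subst hst
  by_cases hs0 : s = 0
  · simp [hs0]
  · by_contra hne
    obtain ⟨f, hf⟩ := exists_apply_ne (K := K) (x := ⟨x, hx⟩) (y := ⟨y, hy⟩) (by
      rintro ⟨⟩
      exact hne rfl)
    exact hf (mul_left_cancel₀ hs0 (h f))

/-- Edwards' separation theorem for finitely many continuous affine functions. -/
theorem exists_between (hK : IsChoquetSimplex K) {f₁ f₂ g₁ g₂ : AffineFunctions K}
    (h₁₁ : ∀ x, f₁.1 x < g₁.1 x) (h₁₂ : ∀ x, f₁.1 x < g₂.1 x) (h₂₁ : ∀ x, f₂.1 x < g₁.1 x)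
    (h₂₂ : ∀ x, f₂.1 x < g₂.1 x) :
    ∃ h : AffineFunctions K, (∀ x, f₁.1 x < h.1 x) ∧ (∀ x, f₂.1 x < h.1 x) ∧
      (∀ x, h.1 x < g₁.1 x) ∧ ∀ x, h.1 x < g₂.1 x := by
  have : CompactSpace K := isCompact_iff_compactSpace.1 hK.compact
  let X := AffineFunctions K
  by_contra! hcon
  let up : X → Set X := fun f => {g | ∀ x, f.1 x < g.1 x}
  have hupc : ∀ f, Convex ℝ (up f) := by
    intro f g hg h hh a b ha hb hab x
    change f.1 x < a * g.1 x + b * h.1 x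
    rcases ha.eq_or_lt with rfl | ha
    · obtain rfl : b = 1 := by linarith
      simpa using hh x
    · have h1 : a * f.1 x < a * g.1 x := by gcongr; exact hg x
      have h2 : b * f.1 x ≤ b * h.1 x := by gcongr; exact (hh x).le
      have h3 : a * f.1 x + b * f.1 x = f.1 x := by rw [← add_mul, hab, one_mul]
      linarith
  -- An interpolant is an `h` for which `T h = (h, h, -h, -h)` lies in a product of four open convex
  -- sets. If there is none, Hahn-Banach separates the product from the range of `T`.
  let T : X →ₗ[ℝ] X × X × X × X :=
    LinearMap.id.prod (LinearMap.id.prod ((-LinearMap.id).prod (-LinearMap.id)))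
  obtain ⟨φ, v, hφ, hφT⟩ := geometric_hahn_banach_open
    (s := up f₁ ×ˢ up f₂ ×ˢ up (-g₁) ×ˢ up (-g₂)) (t := LinearMap.range T)
    ((hupc _).prod ((hupc _).prod ((hupc _).prod (hupc _))))
    ((isOpen_setOf_forall_lt _).prod ((isOpen_setOf_forall_lt _).prod
      ((isOpen_setOf_forall_lt _).prod (isOpen_setOf_forall_lt _))))
    (LinearMap.range T).convex (by
      rw [Set.disjoint_left]
      rintro _ ⟨h1, h2, h3, h4⟩ ⟨h, rfl⟩
      obtain ⟨x, hx⟩ := hcon h h1 h2 fun x => neg_lt_neg_iff.1 (h3 x)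
      exact absurd (neg_lt_neg_iff.1 (h4 x)) (not_lt.2 hx))
  have hv0 : v ≤ 0 := by simpa using hφT 0 (zero_mem _)
  have hT0 : ∀ h, φ (T h) = 0 := by
    intro h
    by_contra hne
    have := hφT (T (((v - 1) / φ (T h)) • h)) ⟨_, rfl⟩
    rw [map_smul, map_smul, smul_eq_mul, div_mul_cancel₀ _ hne] at this
    linarith
  let L : Fin 4 → X →ₗ[ℝ] ℝ := ![
    -(φ.toLinearMap ∘ₗ LinearMap.inl ℝ X (X × X × X)),
    -(φ.toLinearMap ∘ₗ LinearMap.inr ℝ X (X × X × X) ∘ₗ LinearMap.inl ℝ X (X × X)),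
    -(φ.toLinearMap ∘ₗ LinearMap.inr ℝ X (X × X × X) ∘ₗ LinearMap.inr ℝ X (X × X) ∘ₗ
      LinearMap.inl ℝ X X),
    -(φ.toLinearMap ∘ₗ LinearMap.inr ℝ X (X × X × X) ∘ₗ LinearMap.inr ℝ X (X × X) ∘ₗ
      LinearMap.inr ℝ X X)]
  have hL : ∀ a b c d, φ (a, b, c, d) = -(L 0 a + L 1 b + L 2 c + L 3 d) := by
    intro a b c d
    have e : ((a, b, c, d) : X × X × X × X) =
        (a, 0, 0, 0) + (0, b, 0, 0) + (0, 0, c, 0) + (0, 0, 0, d) := by simp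
    rw [e, map_add, map_add, map_add]
    change φ (a, 0, 0, 0) + φ (0, b, 0, 0) + φ (0, 0, c, 0) + φ (0, 0, 0, d) =
      -(-φ (a, 0, 0, 0) + -φ (0, b, 0, 0) + -φ (0, 0, c, 0) + -φ (0, 0, 0, d))
    ring
  have hO : ∀ a ∈ up f₁, ∀ b ∈ up f₂, ∀ c ∈ up (-g₁), ∀ d ∈ up (-g₂),
      0 < L 0 a + L 1 b + L 2 c + L 3 d := by
    intro a ha b hb c hc d hd
    have := hφ (a, b, c, d) ⟨ha, hb, hc, hd⟩
    rw [hL] at this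
    linarith
  have hup1 : ∀ f : X, ∀ p : X, (∀ x, 0 ≤ p.1 x) → ∀ n : ℕ,
      f + const K 1 + (n : ℝ) • p ∈ up f := by
    intro f p hp n x
    change f.1 x < f.1 x + 1 + n * p.1 x
    have := mul_nonneg (Nat.cast_nonneg (α := ℝ) n) (hp x)
    linarith
  have hpos_of : ∀ (l : X →ₗ[ℝ] ℝ) (r : ℝ) (f : X),
      (∀ a ∈ up f, 0 < l a + r) → ∀ p : X, (∀ x, 0 ≤ p.1 x) → 0 ≤ l p := by
    intro l r f hl p hp
    -- `up f` is closed under adding multiples of `p`, along which `l` would tend to `-∞`.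
    by_contra! hneg
    obtain ⟨n, hn⟩ := exists_nat_gt ((l (f + const K 1) + r) / (-l p))
    rw [div_lt_iff₀ (by linarith)] at hn
    have := hl _ (hup1 f p hp n)
    rw [map_add, map_smul, smul_eq_mul] at this
    linarith
  have hmem : ∀ f : X, f + const K 1 ∈ up f := fun f x => by
    change f.1 x < f.1 x + 1
    linarith
  have hL₀ : ∀ p : X, (∀ x, 0 ≤ p.1 x) → 0 ≤ L 0 p := hpos_of _
      (L 1 (f₂ + const K 1) + L 2 (-g₁ + const K 1) + L 3 (-g₂ + const K 1)) f₁
      fun a ha => by linarith [hO a ha _ (hmem _) _ (hmem _) _ (hmem _)]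
  have hL₁ : ∀ p : X, (∀ x, 0 ≤ p.1 x) → 0 ≤ L 1 p := hpos_of _
      (L 0 (f₁ + const K 1) + L 2 (-g₁ + const K 1) + L 3 (-g₂ + const K 1)) f₂
      fun a ha => by linarith [hO _ (hmem _) a ha _ (hmem _) _ (hmem _)]
  have hL₂ : ∀ p : X, (∀ x, 0 ≤ p.1 x) → 0 ≤ L 2 p := hpos_of _
      (L 0 (f₁ + const K 1) + L 1 (f₂ + const K 1) + L 3 (-g₂ + const K 1)) (-g₁)
      fun a ha => by linarith [hO _ (hmem _) _ (hmem _) a ha _ (hmem _)]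
  have hL₃ : ∀ p : X, (∀ x, 0 ≤ p.1 x) → 0 ≤ L 3 p := hpos_of _
      (L 0 (f₁ + const K 1) + L 1 (f₂ + const K 1) + L 2 (-g₁ + const K 1)) (-g₂)
      fun a ha => by linarith [hO _ (hmem _) _ (hmem _) _ (hmem _) a ha]
  have hLpos : ∀ i, ∀ p : X, (∀ x, 0 ≤ p.1 x) → 0 ≤ L i p := by
    intro i
    fin_cases i
    exacts [hL₀, hL₁, hL₂, hL₃]
  choose p hp hpL using fun i => exists_eq_coneEval hK.convex hK.nonempty (L i) (hLpos i)
  -- `φ` vanishes on the range of `T`, so `L 0 + L 1 = L 2 + L 3`; affine functions separate points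
  -- of the cone.
  have hsum : p 0 + p 1 = p 2 + p 3 := by
    refine eq_of_coneEval_eq (add_mem_coneOver hK.convex (hp 0) (hp 1))
      (add_mem_coneOver hK.convex (hp 2) (hp 3)) fun f => ?_
    rw [coneEval_add hK.convex f (hp 0) (hp 1), coneEval_add hK.convex f (hp 2) (hp 3), ← hpL,
      ← hpL, ← hpL, ← hpL]
    have h1 := hT0 f
    have h2 : T f = (f, f, -f, -f) := rfl
    rw [h2, hL, map_neg, map_neg] at h1
    linarith
  obtain ⟨w₁₁, m₁₁, w₁₂, m₁₂, w₂₁, m₂₁, w₂₂, m₂₂, e₀, e₁, e₂, e₃⟩ :=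
    hK.lattice.refinement (fun _ ha _ hb => add_mem_coneOver hK.convex ha hb)
      (hp 0) (hp 1) (hp 2) (hp 3) hsum
  obtain ⟨ε₁₁, p₁₁, k₁₁⟩ := ContinuousMap.exists_pos_add_le h₁₁
  obtain ⟨ε₁₂, p₁₂, k₁₂⟩ := ContinuousMap.exists_pos_add_le h₁₂
  obtain ⟨ε₂₁, p₂₁, k₂₁⟩ := ContinuousMap.exists_pos_add_le h₂₁
  obtain ⟨ε₂₂, p₂₂, k₂₂⟩ := ContinuousMap.exists_pos_add_le h₂₂
  obtain ⟨ε, hε, l₁₁, l₁₂, l₂₁, l₂₂⟩ : ∃ ε > 0, ε + ε ≤ ε₁₁ ∧ ε + ε ≤ ε₁₂ ∧ ε + ε ≤ ε₂₁ ∧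
      ε + ε ≤ ε₂₂ := by
    refine ⟨min (min ε₁₁ ε₁₂) (min ε₂₁ ε₂₂) / 2, by positivity, ?_, ?_, ?_, ?_⟩ <;>
      rw [add_halves] <;> simp
  have hstep : ∀ f : X, f + const K ε ∈ up f := fun f x => by
    change f.1 x < f.1 x + ε
    linarith
  -- After refinement this says that the sum over `i, j` of `fᵢ + ε - (gⱼ - ε)` evaluated at `wᵢⱼ`
  -- is positive, yet each term is at most `0` as `2ε` is within every gap.
  have hpos := hO _ (hstep f₁) _ (hstep f₂) _ (hstep (-g₁)) _ (hstep (-g₂))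
  have en : ∀ (i : Fin 4) (g : X), L i (-g + const K ε) = -L i (g - const K ε) := by
    intro i g
    rw [← map_neg]
    congr 1
    abel
  rw [en, en, hpL, hpL, hpL, hpL, e₀, e₁, e₂, e₃, coneEval_add hK.convex _ m₁₁ m₁₂,
    coneEval_add hK.convex _ m₂₁ m₂₂, coneEval_add hK.convex _ m₁₁ m₂₁,
    coneEval_add hK.convex _ m₁₂ m₂₂] at hpos
  have mono : ∀ (f g : X) (δ : ℝ), (∀ x, f.1 x + δ ≤ g.1 x) → ε + ε ≤ δ → ∀ w ∈ coneOver K,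
      coneEval (f + const K ε).1 w ≤ coneEval (g - const K ε).1 w := by
    intro f g δ h hδ w hw
    refine coneEval_mono (fun x => ?_) hw
    change f.1 x + ε ≤ g.1 x - ε
    linarith [h x]
  linarith [mono _ _ _ k₁₁ l₁₁ _ m₁₁, mono _ _ _ k₁₂ l₁₂ _ m₁₂, mono _ _ _ k₂₁ l₂₁ _ m₂₁,
    mono _ _ _ k₂₂ l₂₂ _ m₂₂]

end LocallyConvex

end AffineFunctions

end AffineFunctions

/-! ### Groups of affine functions with the strict ordering. -/

section StrictlyOrdered

variable {E : Type u} [AddCommGroup E] [Module ℝ E] [TopologicalSpace E] {K : Set E}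
  {G : AddSubgroup (AffineFunctions K)}

namespace StrictlyOrdered

variable (G) in
/-- The inclusion of `G` in the affine functions. -/
def toAffine : StrictlyOrdered G →+ AffineFunctions K := G.subtype

theorem le_of_forall_lt {f g : StrictlyOrdered G} (h : ∀ x : K, f.val x < g.val x) : f ≤ g :=
  Or.inr h

theorem val_nsmul (n : ℕ) (g : StrictlyOrdered G) (x : K) : (n • g).val x = n * g.val x := by
  have h : (n • g).val = n • g.val := congrArg Subtype.val (map_nsmul (toAffine G) n g)
  rw [h]
  simp

theorem pos_of_ne {g : StrictlyOrdered G} (hg : 0 ≤ g) (h0 : g ≠ 0) (x : K) : 0 < g.val x :=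
  (hg.resolve_left (Ne.symm h0)) x

/-- Multiples of a strictly positive function dominate every element. -/
theorem exists_lt_nsmul [CompactSpace K] {p : StrictlyOrdered G} (hp : ∀ x, 0 < p.val x)
    (g : StrictlyOrdered G) : ∃ n : ℕ, ∀ x, g.val x < (n • p).val x := by
  obtain ⟨ε, hε, h⟩ := ContinuousMap.exists_pos_add_le (f := (0 : C(K, ℝ))) (g := p.val) hp
  obtain ⟨n, hn⟩ := exists_nat_gt (‖g.val‖ / ε)
  rw [div_lt_iff₀ hε] at hn
  refine ⟨n, fun x => ?_⟩
  rw [val_nsmul]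
  have h1 : ε ≤ p.val x := by simpa using h x
  calc g.val x ≤ ‖g.val‖ := (le_abs_self _).trans (g.val.norm_coe_le_norm x)
    _ < n * ε := hn
    _ ≤ n * p.val x := by gcongr

theorem isOrderUnit [CompactSpace K] {p : StrictlyOrdered G} (hp : ∀ x, 0 < p.val x) :
    IsOrderUnit p :=
  ⟨le_of_forall_lt hp, fun g =>
    let ⟨n, hn⟩ := exists_lt_nsmul hp g
    ⟨n, le_of_forall_lt hn⟩⟩

/-- By directedness a nonzero order ideal contains a nonzero positive element. Such an element is
strictly positive on all of the compact `K`, hence an order unit, and convexity gives everything. -/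
theorem isSimpleOrdered [CompactSpace K] [Nontrivial G] :
    IsSimpleOrdered (StrictlyOrdered G) := by
  refine ⟨‹Nontrivial G›, fun I hI => or_iff_not_imp_left.2 fun hne => ?_⟩
  obtain ⟨g, hg, hg0⟩ := I.bot_or_exists_ne_zero.resolve_left hne
  obtain ⟨p, hpI, hp⟩ : ∃ p ∈ I, ∀ x : K, 0 < p.val x := by
    obtain ⟨a, ha, b, hb, ha0, hb0, rfl⟩ := hI.directed g hg
    by_cases h : a = 0
    · subst h
      exact ⟨b, hb, pos_of_ne hb0 (by rintro rfl; simp at hg0)⟩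
    · exact ⟨a, ha, pos_of_ne ha0 h⟩
  rw [eq_top_iff]
  intro f _
  obtain ⟨n, h1, h2⟩ := (isOrderUnit hp).exists_abs_le f
  exact hI.convex _ (I.neg_mem (I.nsmul_mem hpI n)) _ (I.nsmul_mem hpI n) f (neg_le.1 h2) h1

theorem eval_mem_traceSpace {w : StrictlyOrdered G} (hw : w.val = 1) (x : K) :
    (fun g : StrictlyOrdered G => g.val x) ∈ traceSpace (StrictlyOrdered G) w := by
  refine ⟨fun a b => rfl, fun g hg => ?_, by simp [hw]⟩
  rcases hg with rfl | hg
  · exact le_rfl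
  · exact (hg x).le

section LocallyConvex

variable [IsTopologicalAddGroup E] [ContinuousSMul ℝ E] [LocallyConvexSpace ℝ E] [T2Space E]

/-- A dense subgroup of the affine functions on a Choquet simplex is a dimension group in the strict
ordering. -/
theorem isDimensionGroup (hK : IsChoquetSimplex K) (hG : Dense (G : Set (AffineFunctions K)))
    {w : StrictlyOrdered G} (hw : ∀ x, 0 < w.val x) : IsDimensionGroup (StrictlyOrdered G) where
  directed a b := by
    have : CompactSpace K := isCompact_iff_compactSpace.1 hK.compact
    obtain ⟨n, hn⟩ := (isOrderUnit hw).2 a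
    obtain ⟨m, hm⟩ := (isOrderUnit hw).2 b
    exact ⟨(n + m) • w,
      hn.trans (nsmul_le_nsmul_left (le_of_forall_lt hw) (Nat.le_add_right n m)),
      hm.trans (nsmul_le_nsmul_left (le_of_forall_lt hw) (Nat.le_add_left m n))⟩
  unperforated n g hn h := by
    have hn' : (0 : ℝ) < n := by exact_mod_cast hn
    rcases h with h | h
    · left
      refine val_injective (ContinuousMap.ext fun x => ?_)
      have h1 := congrArg (fun g : StrictlyOrdered G => g.val x) h
      simp only [val_nsmul] at h1
      have h2 : (0 : StrictlyOrdered G).val x = 0 := rfl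
      rw [h2] at h1 ⊢
      exact ((mul_eq_zero.1 h1.symm).resolve_left hn'.ne').symm
    · right
      intro x
      have h1 := h x
      rw [val_nsmul] at h1
      exact pos_of_mul_pos_right h1 hn'.le
  interpolation a₁ a₂ b₁ b₂ h₁₁ h₁₂ h₂₁ h₂₂ := by
    have : CompactSpace K := isCompact_iff_compactSpace.1 hK.compact
    rcases h₁₁ with rfl | k₁₁
    · exact ⟨a₁, le_rfl, h₂₁, le_rfl, h₁₂⟩
    rcases h₁₂ with rfl | k₁₂
    · exact ⟨a₁, le_rfl, h₂₂, le_of_forall_lt k₁₁, le_rfl⟩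
    rcases h₂₁ with rfl | k₂₁
    · exact ⟨a₂, le_of_forall_lt k₁₁, le_rfl, le_rfl, h₂₂⟩
    rcases h₂₂ with rfl | k₂₂
    · exact ⟨a₂, le_of_forall_lt k₁₂, le_rfl, le_of_forall_lt k₂₁, le_rfl⟩
    obtain ⟨h, hh₁, hh₂, hh₃, hh₄⟩ := AffineFunctions.exists_between hK
      (f₁ := toAffine G a₁) (f₂ := toAffine G a₂) (g₁ := toAffine G b₁) (g₂ := toAffine G b₂)
      k₁₁ k₁₂ k₂₁ k₂₂
    have hup := AffineFunctions.isOpen_setOf_forall_lt (K := K)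
    have hdown : ∀ g : AffineFunctions K,
        IsOpen {f : AffineFunctions K | ∀ x, f.1 x < g.1 x} := fun g => by
      convert (hup (-g)).preimage continuous_neg using 1
      ext f
      exact forall_congr' fun x => neg_lt_neg_iff.symm
    -- The strict interpolants form an open set, nonempty by Edwards' theorem, so the dense `G`
    -- meets it.
    obtain ⟨c, ⟨⟨⟨h1, h2⟩, h3⟩, h4⟩, hc⟩ := hG.inter_open_nonempty _
      ((((hup (toAffine G a₁)).inter (hup (toAffine G a₂))).inter
        (hdown (toAffine G b₁))).inter (hdown (toAffine G b₂))) ⟨h, ⟨⟨hh₁, hh₂⟩, hh₃⟩, hh₄⟩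
    exact ⟨⟨c, hc⟩, le_of_forall_lt h1, le_of_forall_lt h2, le_of_forall_lt h3, le_of_forall_lt h4⟩

/-- The trace space of a dense subgroup of the affine functions on `K` is `K`. -/
theorem exists_homeomorph_traceSpace (hK : IsCompact K) (hconv : Convex ℝ K)
    (hG : Dense (G : Set (AffineFunctions K))) {w : StrictlyOrdered G} (hw : w.val = 1) :
    ∃ e : K ≃ₜ traceSpace (StrictlyOrdered G) w,
      ∀ (x : K) (g : StrictlyOrdered G), (e x : StrictlyOrdered G → ℝ) g = g.val x := by
  have : CompactSpace K := isCompact_iff_compactSpace.1 hK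
  let ev : K → traceSpace (StrictlyOrdered G) w := fun x => ⟨_, eval_mem_traceSpace hw x⟩
  have hcont : Continuous ev :=
    Continuous.subtype_mk (continuous_pi fun g => g.val.continuous) _
  have hinj : Function.Injective ev := by
    intro x y hxy
    by_contra hne
    obtain ⟨f, hf⟩ := AffineFunctions.exists_apply_ne hne
    have ho : IsOpen {f : AffineFunctions K | f.1 x ≠ f.1 y} :=
      isOpen_ne_fun (by fun_prop) (by fun_prop)
    obtain ⟨g, hg, hgG⟩ := hG.inter_open_nonempty _ ho ⟨f, hf⟩
    exact hg (congrFun (congrArg Subtype.val hxy) ⟨g, hgG⟩)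
  have hsurj : Function.Surjective ev := by
    rintro ⟨τ, h1, h2, h3⟩
    obtain ⟨x, hx⟩ := AffineFunctions.exists_eq_eval hconv (toAffine G) (AddMonoidHom.mk' τ h1)
      (e := w) (Subtype.ext hw) h3 fun m hm => h2 m (le_of_forall_lt hm)
    exact ⟨x, Subtype.ext (funext fun g => (hx g).symm)⟩
  exact ⟨Continuous.homeoOfEquivCompactToT2 (f := Equiv.ofBijective ev ⟨hinj, hsurj⟩) hcont,
    fun _ _ => rfl⟩

end LocallyConvex

/-- The trace norm dominates the supremum norm. -/
theorem norm_toAffine_le [CompactSpace K] {w : StrictlyOrdered G} (hw : w.val = 1)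
    (g : StrictlyOrdered G) : ‖toAffine G g‖ ≤ traceNorm w g := by
  have hw' : IsOrderUnit w := isOrderUnit fun x => by simp [hw]
  have hle : ∀ x : K, |g.val x| ≤ traceNorm w g := fun x =>
    le_ciSup (bddAbove_abs_traceSpace hw' g) ⟨_, eval_mem_traceSpace hw x⟩
  change ‖g.val‖ ≤ _
  exact (ContinuousMap.norm_le _ (Real.iSup_nonneg fun τ => abs_nonneg _)).2 hle

/-- The integral span of an `ℝ`-linearly independent set has the property Anti-FD. -/
theorem isAntiFD [CompactSpace K] {B : Set (AffineFunctions K)} (hB : LinearIndepOn ℝ id B)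
    (hG : ∀ g ∈ G, g ∈ Submodule.span ℤ B) {w : StrictlyOrdered G} (hw : w.val = 1) :
    IsAntiFD.{u, v} (StrictlyOrdered G) w := by
  intro H _ _ _ hH z hz φ hφ
  obtain ⟨ψ, hψ⟩ : ∃ ψ : H →+ AffineFunctions K, ∀ h, ψ h = toAffine G (φ h) :=
    ⟨(toAffine G).comp φ, fun _ => rfl⟩
  have hcont : ∀ ε > 0, ∃ δ > 0, ∀ g : H, traceNorm z g < δ → ‖ψ g‖ < ε := by
    intro ε hε
    obtain ⟨δ, hδ, hδ'⟩ := hφ 0 ε hε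
    refine ⟨δ, hδ, fun g hg => ?_⟩
    rw [hψ]
    refine (norm_toAffine_le hw (φ g)).trans_lt ?_
    have := hδ' g (by rwa [sub_zero])
    rwa [map_zero, sub_zero] at this
  have hmem : ∀ g : H, ψ g ∈ Submodule.span ℤ B := fun g => by
    rw [hψ]
    exact hG _ (φ g).2
  refine AddMonoidHom.ext fun h => Subtype.ext ?_
  have h0 := IsProFD.eq_zero_of_mem_span_int (V := AffineFunctions K) hH hz hcont (B := B)
  have h1 := h0 hB hmem h
  rw [hψ] at h1
  exact h1

end StrictlyOrdered

end StrictlyOrdered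

/-! ### Group structure of the integral span. -/

section IntegralSpan

variable {V : Type*} [NormedAddCommGroup V] [NormedSpace ℝ V] {B : Set V}

/-- Finitely generated subgroups of the integral span of an `ℝ`-linearly independent set are
discrete. -/
theorem LinearIndepOn.discreteTopology_of_fg (hB : LinearIndepOn ℝ id B) {L : AddSubgroup V}
    (hL : L ≤ (Submodule.span ℤ B).toAddSubgroup) (hfg : L.FG) : DiscreteTopology L := by
  obtain ⟨s, rfl⟩ := hfg
  obtain ⟨F, hFB, hsF⟩ := exists_finset_subset_span_int s.finite_toSet
    (AddSubgroup.subset_closure.trans hL)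
  have hLF : AddSubgroup.closure (s : Set V) ≤ (Submodule.span ℤ (F : Set V)).toAddSubgroup :=
    (AddSubgroup.closure_le _).2 hsF
  obtain ⟨ε, hε, h⟩ := (hB.mono hFB).exists_pos_le_norm
  refine discreteTopology_of_isOpen_singleton_zero (Metric.isOpen_singleton_iff.2
    ⟨ε, hε, fun y hy => ?_⟩)
  by_contra hne
  rw [dist_zero_right] at hy
  exact absurd hy (not_lt.2 (h y (hLF y.2) fun e => hne (Subtype.ext e)))

/-- Independence over `ℝ` implies independence over `ℤ`, so `B` is a basis of its integral span. -/
theorem LinearIndepOn.free_span_int (hB : LinearIndepOn ℝ id B) :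
    Module.Free ℤ (Submodule.span ℤ B) := by
  have hli : LinearIndependent ℤ ((↑) : B → V) :=
    LinearIndependent.restrict_scalars (R := ℤ) (K := ℝ)
      (by simpa using Int.cast_injective) hB
  have := Module.Free.of_basis (Module.Basis.span hli)
  rwa [Subtype.range_coe] at this

theorem Set.Countable.span_int {V : Type*} [AddCommGroup V] {B : Set V} (hB : B.Countable) :
    Countable (Submodule.span ℤ B) := by
  have := hB.to_subtype
  have : Countable (Submodule.span ℤ (Set.range ((↑) : B → V))) := inferInstance
  rwa [Subtype.range_coe] at this

end IntegralSpan

theorem corollary3p2 {E : Type u} [AddCommGroup E] [Module ℝ E] [TopologicalSpace E]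
    [IsTopologicalAddGroup E] [ContinuousSMul ℝ E] [LocallyConvexSpace ℝ E] [T2Space E]
    (K : Set E) (hK : IsChoquetSimplex K) (hmetr : TopologicalSpace.MetrizableSpace K)
    (hinf : ¬ FiniteDimensional ℝ (vectorSpan ℝ K)) :
    ∃ G : AddSubgroup (AffineFunctions K),
      Countable G ∧
      Dense (G : Set (AffineFunctions K)) ∧
      Module.Free ℤ G ∧
      (∀ L : AddSubgroup (AffineFunctions K), L ≤ G → L.FG → DiscreteTopology L) ∧
      IsDimensionGroup (StrictlyOrdered G) ∧
      IsSimpleOrdered (StrictlyOrdered G) ∧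
      ∃ w : StrictlyOrdered G, w.val = 1 ∧
        IsOrderUnit w ∧
        (∃ e : K ≃ₜ traceSpace (StrictlyOrdered G) w,
          (∀ (x : K) (g : StrictlyOrdered G), (e x : StrictlyOrdered G → ℝ) g = g.val x) ∧
          (∀ (x y z : K) (a b : ℝ), 0 ≤ a → 0 ≤ b → a + b = 1 →
            (z : E) = a • (x : E) + b • (y : E) →
            (e z : StrictlyOrdered G → ℝ) =
              a • (e x : StrictlyOrdered G → ℝ) + b • (e y : StrictlyOrdered G → ℝ))) ∧
        IsAntiFD.{u, v} (StrictlyOrdered G) w := by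
  have : CompactSpace K := isCompact_iff_compactSpace.1 hK.compact
  let := TopologicalSpace.metrizableSpaceMetric K
  have hone : AffineFunctions.const K 1 ≠ 0 := fun h => by
    obtain ⟨x, hx⟩ := hK.nonempty
    exact one_ne_zero (congrArg (fun f : AffineFunctions K => f.1 ⟨x, hx⟩) h)
  -- Including `1` in `B` is what puts the order unit in `G`.
  obtain ⟨B, hBc, hBd, hBi, h1B⟩ := exists_countable_dense_linearIndepOn
    (AffineFunctions.not_finiteDimensional hinf) hone
  let G : AddSubgroup (AffineFunctions K) := (Submodule.span ℤ B).toAddSubgroup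
  let w : StrictlyOrdered G := ⟨AffineFunctions.const K 1, Submodule.subset_span h1B⟩
  have hw : w.val = 1 := rfl
  have hpos : ∀ x, 0 < w.val x := fun x => by simp [hw]
  have hGd : Dense (G : Set (AffineFunctions K)) := hBd.mono Submodule.subset_span
  have : Nontrivial G := ⟨⟨w, 0, fun h => hone (congrArg Subtype.val h)⟩⟩
  obtain ⟨e, he⟩ := StrictlyOrdered.exists_homeomorph_traceSpace hK.compact hK.convex hGd hw
  refine ⟨G, hBc.span_int, hGd, hBi.free_span_int, fun L hL hfg => hBi.discreteTopology_of_fg hL hfg,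
    StrictlyOrdered.isDimensionGroup hK hGd hpos, StrictlyOrdered.isSimpleOrdered, w, hw,
    StrictlyOrdered.isOrderUnit hpos, ⟨e, he, fun x y z a b ha hb hab hz => ?_⟩,
    StrictlyOrdered.isAntiFD hBi (fun g hg => hg) hw⟩
  ext g
  simp only [Pi.add_apply, Pi.smul_apply, smul_eq_mul, he]
  exact (StrictlyOrdered.toAffine G g).2 x y z a b ha hb hab hz
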